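/- All Banach spaces are real. For Banach spaces $X,Y$ let $L(X,Y)$ be the space of bounded linear operators from $X$ to $Y$, with the operator norm. A linear subspace $\mathcal J\subset L(X,Y)$ is a *subideal* of $L(X,Y)$ if $A\circ T\circ B\in\mathcal J$ for all $T\in\mathcal J$, $A\in L(Y,Y)$, $B\in L(X,X)$; it is *closed* if it is closed in the operator norm, *nontrivial* if $\mathcal J\neq\{0\}$, and *proper* if $\mathcal J\neq L(X,Y)$. For a bounded linear operator $S:W\to Z$ between Banach spaces let $\mathcal J^{S}(X,Y)$ be the closure of the subideal of $L(X,Y)$ generated by all operators $A\circ S\circ B$ with $A\in L(Z,Y)$, $B\in L(X,W)$, and let $\mathcal J^{Z}=\mathcal J^{\mathrm{Id}_Z}$. An operator $T\in L(X,Y)$ is *finitely strictly singular* if for every $\varepsilon>0$ there is $n\in\mathbb N$ such that every $n$-dimensional subspace $E\subset X$ contains some $x$ with $\|x\|=1$ and $\|Tx\|\le\varepsilon$; $\mathcal{FSS}(X,Y)$ denotes the set of these operators. For $1\le r\le s\le\infty$ let $I(r,s):\ell_r\to\ell_s$, $x\mapsto x$, be the formal inclusion. **Theorem.** Let $1<p<2<q<\infty$,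 and let $\mathcal J^{S}$, $\mathcal J^{Z}$ and $\mathcal{FSS}$ stand for $\mathcal J^{S}(\ell_p,\ell_q)$, $\mathcal J^{Z}(\ell_p,\ell_q)$ and $\mathcal{FSS}(\ell_p,\ell_q)$. Then $\mathcal J^{I(p,2)}$ and $\mathcal J^{I(2,q)}$ are closed subideals of $L(\ell_p,\ell_q)$, both are contained in $\mathcal{FSS}\cap\mathcal J^{\ell_2}$, and they are incomparable: neither contains the other. More precisely, there are operators $A\in L(\ell_2,\ell_q)$ and $B\in L(\ell_p,\ell_2)$ such that $$T=A\circ I(p,2)\in\mathcal J^{I(p,2)}\setminus\mathcal J^{I(2,q)},\qquad S=I(2,q)\circ B\in\mathcal J^{I(2,q)}\setminus\mathcal J^{I(p,2)} .$$ Consequently $\mathcal J^{I(p,q)}\subsetneq\mathcal{FSS}\cap\mathcal J^{\ell_2}$, and $L(\ell_p,\ell_q)$ has at least $7$ nontrivial proper closed subideals. -/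

import Mathlib

noncomputable section

namespace OperatorIdeals

open scoped ENNReal

/-- The real Banach space `ℓ_p = ℓ_p(ℕ)`. -/
abbrev Ell (p : ℝ≥0∞) : Type := lp (fun _ : ℕ => ℝ) p

/-- For `1 ≤ p ≤ q` every `x ∈ ℓ_p` satisfies `‖x‖_q ≤ ‖x‖_p`. -/
theorem norm_linearMapOfLE_le {p q : ℝ≥0∞} [Fact (1 ≤ p)] [Fact (1 ≤ q)] (h : p ≤ q)
    (x : Ell p) : ‖lp.linearMapOfLE ℝ (fun _ : ℕ => ℝ) h x‖ ≤ ‖x‖ := by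
  have hp0 : p ≠ 0 := (zero_lt_one.trans_le (Fact.out : 1 ≤ p)).ne'
  have hcoord : ∀ i, ‖x i‖ ≤ ‖x‖ := fun i => lp.norm_apply_le_norm hp0 x i
  by_cases hq : q = ∞
  · subst hq
    exact lp.norm_le_of_forall_le (norm_nonneg x) hcoord
  · have hp : p ≠ ∞ := ne_top_of_le_ne_top hq h
    have hpr : 0 < p.toReal := ENNReal.toReal_pos hp0 hp
    have hpq : p.toReal ≤ q.toReal := ENNReal.toReal_mono hq h
    have hqr : 0 < q.toReal := hpr.trans_le hpq
    refine lp.norm_le_of_forall_sum_le hqr (norm_nonneg x) fun s => ?_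
    have hsplit : ∀ a : ℝ, 0 ≤ a → a ^ q.toReal = a ^ (q.toReal - p.toReal) * a ^ p.toReal := by
      intro a ha
      rw [← Real.rpow_add_of_nonneg ha (sub_nonneg.2 hpq) hpr.le, sub_add_cancel]
    calc ∑ i ∈ s, ‖lp.linearMapOfLE ℝ (fun _ : ℕ => ℝ) h x i‖ ^ q.toReal
        = ∑ i ∈ s, ‖x i‖ ^ q.toReal := rfl
      _ ≤ ∑ i ∈ s, ‖x‖ ^ (q.toReal - p.toReal) * ‖x i‖ ^ p.toReal := by
          refine Finset.sum_le_sum fun i _ => ?_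
          rw [hsplit _ (norm_nonneg (x i))]
          have := Real.rpow_le_rpow (norm_nonneg (x i)) (hcoord i) (sub_nonneg.2 hpq)
          gcongr
      _ = ‖x‖ ^ (q.toReal - p.toReal) * ∑ i ∈ s, ‖x i‖ ^ p.toReal := by
          rw [Finset.mul_sum]
      _ ≤ ‖x‖ ^ (q.toReal - p.toReal) * ‖x‖ ^ p.toReal := by
          have := lp.sum_rpow_le_norm_rpow hpr x s
          gcongr
      _ = ‖x‖ ^ q.toReal := (hsplit _ (norm_nonneg x)).symm

/-- The formal inclusion `I(p,q) : ℓ_p → ℓ_q`, `x ↦ x`, for `1 ≤ p ≤ q ≤ ∞`. -/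
def formalInclusion (p q : ℝ≥0∞) [Fact (1 ≤ p)] [Fact (1 ≤ q)] (h : p ≤ q) : Ell p →L[ℝ] Ell q :=
  (lp.linearMapOfLE ℝ (fun _ : ℕ => ℝ) h).mkContinuous 1 fun x => by
    simpa using norm_linearMapOfLE_le h x

@[simp]
theorem formalInclusion_apply {p q : ℝ≥0∞} [Fact (1 ≤ p)] [Fact (1 ≤ q)] (h : p ≤ q)
    (x : Ell p) (n : ℕ) : formalInclusion p q h x n = x n := rfl

section Ideals

variable {X Y W Z : Type*}
  [NormedAddCommGroup X] [NormedSpace ℝ X] [NormedAddCommGroup Y] [NormedSpace ℝ Y]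
  [NormedAddCommGroup W] [NormedSpace ℝ W] [NormedAddCommGroup Z] [NormedSpace ℝ Z]

/-- A linear subspace `J` of `L(X,Y)` is a subideal if `A ∘ T ∘ B ∈ J` for all `T ∈ J`,
`A ∈ L(Y)` and `B ∈ L(X)`. -/
def IsSubideal (J : Submodule ℝ (X →L[ℝ] Y)) : Prop :=
  ∀ (A : Y →L[ℝ] Y) (B : X →L[ℝ] X), ∀ T ∈ J, A ∘L T ∘L B ∈ J

/-- A closed subideal is a subideal which is closed in the operator norm. -/
def IsClosedSubideal (J : Submodule ℝ (X →L[ℝ] Y)) : Prop :=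
  IsSubideal J ∧ IsClosed (J : Set (X →L[ℝ] Y))

/-- The subideal of `L(X,Y)` generated by a set of operators: the smallest subideal
containing the set. -/
def generatedSubideal (𝒮 : Set (X →L[ℝ] Y)) : Submodule ℝ (X →L[ℝ] Y) :=
  sInf {J | IsSubideal J ∧ 𝒮 ⊆ J}

/-- `T ∈ L(X,Y)` factors through `S ∈ L(W,Z)`. -/
def FactorsThrough (S : W →L[ℝ] Z) (T : X →L[ℝ] Y) : Prop :=
  ∃ (A : Z →L[ℝ] Y) (B : X →L[ℝ] W), T = A ∘L S ∘L B

/-- `J^S(X,Y)`: the closure in the operator norm of the subideal of `L(X,Y)` generated by the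
operators which factor through `S`. -/
def factorIdeal (X Y : Type*) [NormedAddCommGroup X] [NormedSpace ℝ X]
    [NormedAddCommGroup Y] [NormedSpace ℝ Y] (S : W →L[ℝ] Z) : Submodule ℝ (X →L[ℝ] Y) :=
  (generatedSubideal {T : X →L[ℝ] Y | FactorsThrough S T}).topologicalClosure

/-- `T ∈ L(X,Y)` is finitely strictly singular: for every `ε > 0` there is `n` such that every
`n`-dimensional subspace of `X` contains a norm one vector `x` with `‖T x‖ ≤ ε`. (The zero
subspace has no norm one vectors, so such an `n` is automatically positive.) -/
def FinitelyStrictlySingular (T : X →L[ℝ] Y) : Prop :=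
  ∀ ε : ℝ, 0 < ε → ∃ n : ℕ, ∀ E : Submodule ℝ X, Module.finrank ℝ E = n →
    ∃ x ∈ E, ‖x‖ = 1 ∧ ‖T x‖ ≤ ε

/-- `FSS(X,Y)`, the set of finitely strictly singular operators. -/
def FSS (X Y : Type*) [NormedAddCommGroup X] [NormedSpace ℝ X]
    [NormedAddCommGroup Y] [NormedSpace ℝ Y] : Set (X →L[ℝ] Y) :=
  {T | FinitelyStrictlySingular T}

end Ideals

end OperatorIdeals

end

/-!
Write `J^S` for the closed subideal generated by an operator `S`. Everything rests on separating
ideals by averaged trace pairings `Φ_n(R) = (1 / |κ_n|) ∑ i, L_{n,i} (R x_{n,i})`, which are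
bounded uniformly in `n` on `L(ℓ_p, ℓ_q)`: if `Φ_n (A ∘ S ∘ B) → 0` for all `A` and `B`, then
`Φ_n → 0` on `J^S` (`notMem_factorIdeal_of_pairing`). The operators to be separated are block
diagonal (`exists_block_operator`), and copies of `ℓ_2^n` in `ℓ_r^N`, `N = 2^n`, are spanned by
Rademacher functions, through Khintchine's inequality (`avg_abs_rad_rpow_le`,
`exists_eucl_rpow_le_avg`).

For the incomparability, let `A : ℓ_2 → ℓ_q` map the unit vectors of the `n`-th block to Rademacher
functions and let `B : ℓ_p → ℓ_2` be the transpose of such an operator. On `A ∘ I(p,2)` and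
`I(2,q) ∘ B` suitable `Φ_n` equal one. On an operator factoring through `I(2,q)`, respectively
`I(p,2)`, they are sums `∑ k, ∑ i, g_i(k) y_i(k)`, in which one of the square functions is
controlled by Khintchine's lower inequality in an `ℓ_r` with `r < 2`, and the other is bounded in
`ℓ_2` and better than trivially in `ℓ_∞`; Hölder's inequality then gives a negative power of `n`
(`sum_mul_le_of_interpolation`).

The formal inclusions are finitely strictly singular because every subspace of `ℓ_2` of large
dimension contains a vector with small coordinates, a random signed sum of an orthonormal basis
(`exists_flat_vector`). The finitely strictly singular operators form a closed subideal
(`isClosedSubideal_fss`).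

The seven ideals are `J^ℝ` (the closure of the finite rank operators), `J^{I(p,q)}`, `J^{I(p,2)}`,
`J^{I(2,q)}`, the closed sum of the last two, `FSS`, and `J^{ℓ_2}`. The operator `I(p,q)` lies in all
of them except `J^ℝ`, and the second to the fifth lie in both `FSS` and `J^{ℓ_2}`, so it remains to
see that neither of these two contains the other. The composition `A ∘ B` lies in `J^{ℓ_2}`
and is an isomorphism on copies of `ℓ_2^n`, so it is not finitely strictly singular. In the other
direction, an operator in `FSS` outside `J^{ℓ_2}` (`exists_fss_notMem_factorIdeal_id`) is built from
a Hadamard matrix `ε` of size `a` and `a` orthonormal bases `O_m` of `ℝ^b` with very small mutual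
coherence. The `l`-th row of blocks of `(ε_{lm} O_m)` is bounded from `ℓ_r^{ab}` to `ℓ_2^b`, for a
fixed `r ∈ (p,2)`, by an absolute constant (`eucl_frame_le`), so `a^{-1/q} (ε_{lm} O_m)` is bounded
from `ℓ_r^{ab}` to `ℓ_q^a(ℓ_2^b)` and factors through the finitely strictly singular `I(p,r)`;
whereas on `ℓ_2` the matrix is only `√a` times an isometry, and its trace pairing with operators
factoring through `ℓ_2` is of order `a^{1/q - 1/2}`.
-/

namespace OperatorIdeals

open scoped ENNReal Topology
open Filter

/-! ### Closed subideals generated by factorization -/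

section Ideals

variable {X Y W Z V U : Type*}
  [NormedAddCommGroup X] [NormedSpace ℝ X] [NormedAddCommGroup Y] [NormedSpace ℝ Y]
  [NormedAddCommGroup W] [NormedSpace ℝ W] [NormedAddCommGroup Z] [NormedSpace ℝ Z]
  [NormedAddCommGroup V] [NormedSpace ℝ V] [NormedAddCommGroup U] [NormedSpace ℝ U]

theorem IsSubideal.topologicalClosure {J : Submodule ℝ (X →L[ℝ] Y)} (hJ : IsSubideal J) :
    IsClosedSubideal J.topologicalClosure := by
  refine ⟨fun A B T hT => ?_, J.isClosed_topologicalClosure⟩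
  have hc : Continuous fun R : X →L[ℝ] Y => A ∘L R ∘L B :=
    continuous_const.clm_comp (continuous_id.clm_comp continuous_const)
  exact map_mem_closure (f := fun R : X →L[ℝ] Y => A ∘L R ∘L B) hc hT fun R hR => hJ A B R hR

theorem IsSubideal.sup {I J : Submodule ℝ (X →L[ℝ] Y)} (hI : IsSubideal I) (hJ : IsSubideal J) :
    IsSubideal (I ⊔ J) := by
  intro A B T hT
  obtain ⟨R, hR, R', hR', rfl⟩ := Submodule.mem_sup.1 hT
  rw [ContinuousLinearMap.add_comp, ContinuousLinearMap.comp_add]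
  exact add_mem (Submodule.mem_sup_left (hI A B R hR)) (Submodule.mem_sup_right (hJ A B R' hR'))

theorem isSubideal_generatedSubideal (𝒮 : Set (X →L[ℝ] Y)) :
    IsSubideal (generatedSubideal 𝒮) := by
  intro A B T hT
  rw [generatedSubideal, Submodule.mem_sInf] at hT ⊢
  exact fun J hJ => hJ.1 A B T (hT J hJ)

theorem isClosedSubideal_factorIdeal (S : W →L[ℝ] Z) : IsClosedSubideal (factorIdeal X Y S) :=
  (isSubideal_generatedSubideal _).topologicalClosure

theorem mem_factorIdeal (S : W →L[ℝ] Z) (A : Z →L[ℝ] Y) (B : X →L[ℝ] W) :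
    A ∘L S ∘L B ∈ factorIdeal X Y S := by
  refine Submodule.le_topologicalClosure _ ?_
  rw [generatedSubideal, Submodule.mem_sInf]
  exact fun J hJ => hJ.2 ⟨A, B, rfl⟩

theorem comp_mem_factorIdeal_left (S : X →L[ℝ] Z) (A : Z →L[ℝ] Y) :
    A ∘L S ∈ factorIdeal X Y S := by
  have h := mem_factorIdeal S A (ContinuousLinearMap.id ℝ X)
  rwa [ContinuousLinearMap.comp_id] at h

theorem comp_mem_factorIdeal_right (S : W →L[ℝ] Y) (B : X →L[ℝ] W) :
    S ∘L B ∈ factorIdeal X Y S := by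
  have h := mem_factorIdeal S (ContinuousLinearMap.id ℝ Y) B
  rwa [ContinuousLinearMap.id_comp] at h

/-- The operators that factor through `S` are stable under composition on both sides, so their
linear span is already a subideal; hence a closed subspace containing all of them contains
`J^S`. -/
theorem factorIdeal_le {S : W →L[ℝ] Z} {J : Submodule ℝ (X →L[ℝ] Y)}
    (hJ : IsClosed (J : Set (X →L[ℝ] Y))) (h : ∀ A B, A ∘L S ∘L B ∈ J) :
    factorIdeal X Y S ≤ J := by
  refine Submodule.topologicalClosure_minimal _ ?_ hJ
  have hspan : IsSubideal (Submodule.span ℝ {T : X →L[ℝ] Y | FactorsThrough S T}) := by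
    intro A B T hT
    induction hT using Submodule.span_induction with
    | mem T hT =>
      obtain ⟨A', B', rfl⟩ := hT
      exact Submodule.subset_span ⟨A ∘L A', B' ∘L B, rfl⟩
    | zero => simp
    | add T T' _ _ h h' =>
      rw [ContinuousLinearMap.add_comp, ContinuousLinearMap.comp_add]
      exact add_mem h h'
    | smul c T _ h =>
      rw [ContinuousLinearMap.smul_comp, ContinuousLinearMap.comp_smul]
      exact Submodule.smul_mem _ c h
  have hle : generatedSubideal {T : X →L[ℝ] Y | FactorsThrough S T} ≤
      Submodule.span ℝ {T : X →L[ℝ] Y | FactorsThrough S T} :=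
    sInf_le ⟨hspan, Submodule.subset_span⟩
  refine hle.trans (Submodule.span_le.2 ?_)
  rintro _ ⟨A, B, rfl⟩
  exact h A B

theorem factorIdeal_comp_le (R : Z →L[ℝ] U) (S : W →L[ℝ] Z) (T : V →L[ℝ] W) :
    factorIdeal X Y (R ∘L S ∘L T) ≤ factorIdeal X Y S :=
  factorIdeal_le (isClosedSubideal_factorIdeal S).2 fun A B =>
    mem_factorIdeal S (A ∘L R) (T ∘L B)

/-- A uniformly bounded sequence of functionals which tends to zero on all operators factoring
through `S` tends to zero on all of `J^S`. -/
theorem tendsto_zero_of_mem_factorIdeal {S : W →L[ℝ] Z} (Φ : ℕ → (X →L[ℝ] Y) →ₗ[ℝ] ℝ) (C : ℝ)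
    (hC : ∀ n T, |Φ n T| ≤ C * ‖T‖)
    (h : ∀ A B, Tendsto (fun n => Φ n (A ∘L S ∘L B)) atTop (𝓝 0)) {T : X →L[ℝ] Y}
    (hT : T ∈ factorIdeal X Y S) : Tendsto (fun n => Φ n T) atTop (𝓝 0) := by
  let J : Submodule ℝ (X →L[ℝ] Y) :=
    { carrier := {T | Tendsto (fun n => Φ n T) atTop (𝓝 0)}
      zero_mem' := by simp
      add_mem' := fun {a b} ha hb => by
        simpa using Tendsto.add (f := fun n => Φ n a) (g := fun n => Φ n b) ha hb
      smul_mem' := fun c a ha => by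
        simpa using Tendsto.const_mul (f := fun n => Φ n a) c ha }
  have hJ : IsClosed (J : Set (X →L[ℝ] Y)) := by
    refine isClosed_of_closure_subset fun R hR => ?_
    change Tendsto (fun n => Φ n R) atTop (𝓝 0)
    rw [Metric.tendsto_atTop]
    intro ε hε
    obtain ⟨R', hR', hd⟩ := Metric.mem_closure_iff.1 hR (ε / (2 * (|C| + 1))) (by positivity)
    obtain ⟨N, hN⟩ := Metric.tendsto_atTop.1 (show Tendsto (fun n => Φ n R') atTop (𝓝 0) from hR')
      (ε / 2) (by positivity)
    refine ⟨N, fun n hn => ?_⟩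
    have h1 := hN n hn
    rw [Real.dist_eq, sub_zero] at h1 ⊢
    have h2 : |Φ n (R - R')| ≤ (|C| + 1) * ‖R - R'‖ :=
      (hC n _).trans (by gcongr; linarith [le_abs_self C])
    have h3 : (|C| + 1) * ‖R - R'‖ < ε / 2 := by
      rw [dist_eq_norm, lt_div_iff₀ (by positivity)] at hd
      linarith
    have h4 : Φ n R = Φ n (R - R') + Φ n R' := by rw [map_sub]; ring
    rw [h4]
    exact (abs_add_le _ _).trans_lt (by linarith)
  exact factorIdeal_le hJ h hT

end Ideals

/-! ### Finitely strictly singular operators -/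

section FSS

variable {X Y W Z : Type*}
  [NormedAddCommGroup X] [NormedSpace ℝ X] [NormedAddCommGroup Y] [NormedSpace ℝ Y]
  [NormedAddCommGroup W] [NormedSpace ℝ W] [NormedAddCommGroup Z] [NormedSpace ℝ Z]

/-- A subspace of dimension at least `n` contains one of dimension exactly `n`. -/
theorem exists_le_finrank_eq {n : ℕ} (E : Submodule ℝ X) (h : n ≤ Module.finrank ℝ E) :
    ∃ F ≤ E, Module.finrank ℝ F = n := by
  obtain ⟨f, hf⟩ := exists_linearIndependent_of_le_finrank h
  refine ⟨(Submodule.span ℝ (Set.range f)).map E.subtype, ?_, ?_⟩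
  · rintro _ ⟨y, -, rfl⟩
    exact y.2
  · rw [← (Submodule.equivMapOfInjective E.subtype E.injective_subtype _).finrank_eq,
      finrank_span_eq_card hf, Fintype.card_fin]

/-- Homogeneous form of finite strict singularity. -/
theorem finitelyStrictlySingular_iff {T : X →L[ℝ] Y} :
    FinitelyStrictlySingular T ↔ ∀ ε : ℝ, 0 < ε → ∃ n : ℕ, 0 < n ∧ ∀ E : Submodule ℝ X,
      n ≤ Module.finrank ℝ E → ∃ x ∈ E, x ≠ 0 ∧ ‖T x‖ ≤ ε * ‖x‖ := by
  constructor
  · intro h ε hε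
    obtain ⟨n, hn⟩ := h ε hε
    refine ⟨n, ?_, fun E hE => ?_⟩
    · rcases Nat.eq_zero_or_pos n with rfl | h0
      · obtain ⟨x, hx, hx1, -⟩ := hn ⊥ (finrank_bot ℝ X)
        rw [Submodule.mem_bot] at hx
        simp [hx] at hx1
      · exact h0
    · obtain ⟨F, hFE, hF⟩ := exists_le_finrank_eq E hE
      obtain ⟨x, hx, hx1, hx2⟩ := hn F hF
      refine ⟨x, hFE hx, ?_, by rwa [hx1, mul_one]⟩
      rintro rfl
      simp at hx1
  · intro h ε hε
    obtain ⟨n, -, hn⟩ := h ε hε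
    refine ⟨n, fun E hE => ?_⟩
    obtain ⟨x, hx, hx0, hxT⟩ := hn E hE.ge
    have hpos : 0 < ‖x‖ := norm_pos_iff.2 hx0
    refine ⟨‖x‖⁻¹ • x, E.smul_mem _ hx, ?_, ?_⟩
    · rw [norm_smul, norm_inv, norm_norm, inv_mul_cancel₀ hpos.ne']
    · rw [map_smul, norm_smul, norm_inv, norm_norm, inv_mul_le_iff₀ hpos]
      linarith

/-- A finitely strictly singular operator is small on a whole `m`-dimensional subspace of every
subspace of sufficiently large dimension. In the induction a vector `x` with `‖T x‖` small is
adjoined to an `m`-dimensional subspace of the kernel of a norming functional of `x`, so that the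
two components of `a • x + y` have norm at most twice that of the sum. -/
theorem FinitelyStrictlySingular.exists_subspace {T : X →L[ℝ] Y}
    (hT : FinitelyStrictlySingular T) (m : ℕ) : ∀ δ : ℝ, 0 < δ → ∃ N : ℕ, ∀ E : Submodule ℝ X,
      N ≤ Module.finrank ℝ E → ∃ F ≤ E, Module.finrank ℝ F = m ∧ ∀ x ∈ F, ‖T x‖ ≤ δ * ‖x‖ := by
  induction m with
  | zero =>
    intro δ _
    exact ⟨0, fun E _ => ⟨⊥, bot_le, finrank_bot ℝ X, fun x hx => by
      rw [Submodule.mem_bot] at hx; simp [hx]⟩⟩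
  | succ m ih =>
    intro δ hδ
    obtain ⟨N, hN⟩ := ih (δ / 3) (by positivity)
    obtain ⟨n, hn0, hn⟩ := finitelyStrictlySingular_iff.1 hT (δ / 3) (by positivity)
    refine ⟨N + n, fun E hE => ?_⟩
    have hfin : FiniteDimensional ℝ E := FiniteDimensional.of_finrank_pos (by omega)
    obtain ⟨x, hxE, hx0, hxT⟩ := hn E (by omega)
    have hxn : ‖x‖ ≠ 0 := norm_ne_zero_iff.2 hx0
    obtain ⟨φ, hφ1, hφx⟩ := exists_dual_vector ℝ x hxn
    have hker : N ≤ Module.finrank ℝ (E ⊓ φ.toLinearMap.ker : Submodule ℝ X) := by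
      have h1 := LinearMap.finrank_range_add_finrank_ker (φ.toLinearMap.domRestrict E)
      have h2 : Module.finrank ℝ (φ.toLinearMap.domRestrict E).range ≤ 1 :=
        (Submodule.finrank_le _).trans (Module.finrank_self ℝ).le
      have h3 : (φ.toLinearMap.domRestrict E).ker.map E.subtype = E ⊓ φ.toLinearMap.ker := by
        ext y
        simp [and_comm]
      have h4 := (Submodule.equivMapOfInjective E.subtype E.injective_subtype
        (φ.toLinearMap.domRestrict E).ker).finrank_eq
      rw [h3] at h4
      omega
    obtain ⟨F, hFE, hFm, hFT⟩ := hN _ hker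
    have hxF : x ∉ F := fun hx => by
      have : φ x = 0 := (hFE hx).2
      rw [hφx] at this
      exact hxn (by exact_mod_cast this)
    refine ⟨F ⊔ Submodule.span ℝ {x}, ?_, ?_, ?_⟩
    · exact sup_le (hFE.trans inf_le_left)
        ((Submodule.span_singleton_le_iff_mem _ _).2 hxE)
    · have hFfin : FiniteDimensional ℝ F := Submodule.finiteDimensional_of_le
        (hFE.trans inf_le_left)
      have h1 := Submodule.finrank_sup_add_finrank_inf_eq F (Submodule.span ℝ {x})
      have h2 : F ⊓ Submodule.span ℝ {x} = ⊥ :=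
        ((Submodule.disjoint_span_singleton' hx0).2 hxF).eq_bot
      rw [h2, finrank_bot, finrank_span_singleton hx0, hFm] at h1
      omega
    · intro z hz
      obtain ⟨y, hy, w, hw, rfl⟩ := Submodule.mem_sup.1 hz
      obtain ⟨a, rfl⟩ := Submodule.mem_span_singleton.1 hw
      have hφy : φ y = 0 := (hFE hy).2
      have hax : ‖a • x‖ ≤ ‖y + a • x‖ := by
        have h1 := φ.le_opNorm (y + a • x)
        rw [map_add, map_smul, hφy, hφx, zero_add, hφ1, one_mul] at h1
        simpa [norm_smul] using h1
      have hyn : ‖y‖ ≤ 2 * ‖y + a • x‖ := by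
        have := norm_sub_le (y + a • x) (a • x)
        rw [add_sub_cancel_right] at this
        linarith
      calc ‖T (y + a • x)‖ ≤ ‖T y‖ + ‖a‖ * ‖T x‖ := by
            rw [map_add, map_smul, ← norm_smul]; exact norm_add_le _ _
        _ ≤ δ / 3 * ‖y‖ + ‖a‖ * (δ / 3 * ‖x‖) := by gcongr; exact hFT y hy
        _ = δ / 3 * ‖y‖ + δ / 3 * ‖a • x‖ := by rw [norm_smul]; ring
        _ ≤ δ / 3 * (2 * ‖y + a • x‖) + δ / 3 * ‖y + a • x‖ := by gcongr
        _ = δ * ‖y + a • x‖ := by ring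

theorem FinitelyStrictlySingular.add {T T' : X →L[ℝ] Y} (hT : FinitelyStrictlySingular T)
    (hT' : FinitelyStrictlySingular T') : FinitelyStrictlySingular (T + T') := by
  rw [finitelyStrictlySingular_iff]
  intro ε hε
  obtain ⟨n, hn0, hn⟩ := finitelyStrictlySingular_iff.1 hT' (ε / 2) (by positivity)
  obtain ⟨N, hN⟩ := hT.exists_subspace n (ε / 2) (by positivity)
  refine ⟨max N 1, by simp, fun E hE => ?_⟩
  obtain ⟨F, hFE, hF, hFT⟩ := hN E ((le_max_left _ _).trans hE)
  obtain ⟨x, hx, hx0, hxT⟩ := hn F hF.ge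
  refine ⟨x, hFE hx, hx0, ?_⟩
  calc ‖(T + T') x‖ ≤ ‖T x‖ + ‖T' x‖ := norm_add_le _ _
    _ ≤ ε * ‖x‖ := by linarith [hFT x hx]

theorem FinitelyStrictlySingular.comp_left {T : X →L[ℝ] Y} (hT : FinitelyStrictlySingular T)
    (A : Y →L[ℝ] Z) : FinitelyStrictlySingular (A ∘L T) := by
  rw [finitelyStrictlySingular_iff] at hT ⊢
  intro ε hε
  obtain ⟨n, hn0, hn⟩ := hT (ε / (‖A‖ + 1)) (by positivity)
  refine ⟨n, hn0, fun E hE => ?_⟩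
  obtain ⟨x, hx, hx0, hxT⟩ := hn E hE
  refine ⟨x, hx, hx0, ?_⟩
  calc ‖A (T x)‖ ≤ (‖A‖ + 1) * ‖T x‖ := (A.le_opNorm _).trans (by gcongr; linarith)
    _ ≤ (‖A‖ + 1) * (ε / (‖A‖ + 1) * ‖x‖) := by gcongr
    _ = ε * ‖x‖ := by field_simp

theorem FinitelyStrictlySingular.comp_right {T : X →L[ℝ] Y} (hT : FinitelyStrictlySingular T)
    (B : W →L[ℝ] X) : FinitelyStrictlySingular (T ∘L B) := by
  rw [finitelyStrictlySingular_iff] at hT ⊢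
  intro ε hε
  obtain ⟨n, hn0, hn⟩ := hT (ε / (‖B‖ + 1)) (by positivity)
  refine ⟨n, hn0, fun E hE => ?_⟩
  by_cases hinj : ∃ x ∈ E, x ≠ 0 ∧ B x = 0
  · obtain ⟨x, hx, hx0, hBx⟩ := hinj
    exact ⟨x, hx, hx0, by simp [hBx]; positivity⟩
  · push Not at hinj
    have hi : Function.Injective (B.toLinearMap.domRestrict E) := by
      rw [← LinearMap.ker_eq_bot, LinearMap.ker_eq_bot']
      intro x hx
      by_contra hx0
      exact hinj x x.2 (by simpa using hx0) hx
    have hr : n ≤ Module.finrank ℝ (B.toLinearMap.domRestrict E).range := by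
      rwa [LinearMap.finrank_range_of_inj hi]
    obtain ⟨y, ⟨x, rfl⟩, hy0, hyT⟩ := hn _ hr
    refine ⟨x, x.2, fun h0 => hy0 ?_, ?_⟩
    · simp [h0]
    · calc ‖T (B x)‖ ≤ ε / (‖B‖ + 1) * ‖B x‖ := hyT
        _ ≤ ε / (‖B‖ + 1) * ((‖B‖ + 1) * ‖(x : W)‖) := by
            gcongr
            exact (B.le_opNorm _).trans (by gcongr; linarith)
        _ = ε * ‖(x : W)‖ := by field_simp

/-- The finitely strictly singular operators as a linear subspace of `L(X,Y)`. -/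
def fssSubmodule (X Y : Type*) [NormedAddCommGroup X] [NormedSpace ℝ X]
    [NormedAddCommGroup Y] [NormedSpace ℝ Y] : Submodule ℝ (X →L[ℝ] Y) where
  carrier := FSS X Y
  zero_mem' := by
    refine finitelyStrictlySingular_iff.2 fun ε hε => ⟨1, one_pos, fun E hE => ?_⟩
    have hfin : FiniteDimensional ℝ E := FiniteDimensional.of_finrank_pos hE
    obtain ⟨x, hx⟩ := (Module.finrank_pos_iff_exists_ne_zero (R := ℝ) (M := E)).1 hE
    exact ⟨x, x.2, by simpa using hx, by simp; positivity⟩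
  add_mem' h h' := FinitelyStrictlySingular.add h h'
  smul_mem' c T hT := by
    have := hT.comp_left (c • ContinuousLinearMap.id ℝ Y)
    simpa [FSS] using this

theorem isClosedSubideal_fss : IsClosedSubideal (fssSubmodule X Y) := by
  refine ⟨fun A B T hT => (FinitelyStrictlySingular.comp_right hT B).comp_left A, ?_⟩
  refine isClosed_of_closure_subset fun T hT => ?_
  change FinitelyStrictlySingular T
  rw [finitelyStrictlySingular_iff]
  intro ε hε
  obtain ⟨R, hR, hd⟩ := Metric.mem_closure_iff.1 hT (ε / 2) (by positivity)
  obtain ⟨n, hn0, hn⟩ := finitelyStrictlySingular_iff.1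
    (show FinitelyStrictlySingular R from hR) (ε / 2) (by positivity)
  refine ⟨n, hn0, fun E hE => ?_⟩
  obtain ⟨x, hx, hx0, hxR⟩ := hn E hE
  refine ⟨x, hx, hx0, ?_⟩
  rw [dist_eq_norm] at hd
  calc ‖T x‖ = ‖(T - R) x + R x‖ := by simp
    _ ≤ ‖T - R‖ * ‖x‖ + ε / 2 * ‖x‖ :=
        (norm_add_le _ _).trans (add_le_add ((T - R).le_opNorm x) hxR)
    _ ≤ ε / 2 * ‖x‖ + ε / 2 * ‖x‖ := by gcongr
    _ = ε * ‖x‖ := by ring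

theorem factorIdeal_le_fss {S : W →L[ℝ] Z} (hS : FinitelyStrictlySingular S) :
    factorIdeal X Y S ≤ fssSubmodule X Y :=
  factorIdeal_le isClosedSubideal_fss.2 fun A B => (hS.comp_right B).comp_left A

end FSS

/-! ### Random signs and Khintchine's inequality -/

section Khintchine

variable {ι : Type} [Fintype ι]

/-- The sign `±1` encoded by a Boolean. -/
def sgn (b : Bool) : ℝ := if b then 1 else -1

/-- The Rademacher sum `∑ i, ± a i` for the choice of signs `w`. -/
def rad (a : ι → ℝ) (w : ι → Bool) : ℝ := ∑ i, a i * sgn (w i)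

/-- The Euclidean norm of a finite family of reals. -/
noncomputable def eucl {κ : Type*} [Fintype κ] (a : κ → ℝ) : ℝ := √(∑ i, a i ^ 2)

theorem eucl_nonneg {κ : Type*} [Fintype κ] (a : κ → ℝ) : 0 ≤ eucl a := Real.sqrt_nonneg _

theorem eucl_sq {κ : Type*} [Fintype κ] (a : κ → ℝ) : eucl a ^ 2 = ∑ i, a i ^ 2 :=
  Real.sq_sqrt (Finset.sum_nonneg fun _ _ => sq_nonneg _)

theorem sgn_mul_self (b : Bool) : sgn b * sgn b = 1 := by cases b <;> simp [sgn]

theorem sgn_sq (b : Bool) : sgn b ^ 2 = 1 := by rw [sq, sgn_mul_self]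

theorem eucl_sgn (w : ι → Bool) : eucl (fun i => sgn (w i)) = √(Fintype.card ι) := by
  simp [eucl, sgn_sq]

theorem rad_neg (a : ι → ℝ) (w : ι → Bool) : rad (fun i => -a i) w = -rad a w := by
  simp [rad]

theorem rad_smul (c : ℝ) (a : ι → ℝ) (w : ι → Bool) :
    rad (fun i => c * a i) w = c * rad a w := by
  simp only [rad, Finset.mul_sum, mul_assoc]

theorem eucl_eq_zero {κ : Type*} [Fintype κ] {a : κ → ℝ} (h : eucl a = 0) : a = 0 := by
  have h1 : ∑ i, a i ^ 2 = 0 := by rw [← eucl_sq, h]; simp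
  ext i
  have := (Finset.sum_eq_zero_iff_of_nonneg fun i _ => sq_nonneg (a i)).1 h1 i (Finset.mem_univ i)
  simpa using this

theorem eucl_smul {κ : Type*} [Fintype κ] {c : ℝ} (hc : 0 ≤ c) (a : κ → ℝ) :
    eucl (fun i => c * a i) = c * eucl a := by
  simp only [eucl, mul_pow, ← Finset.mul_sum]
  rw [Real.sqrt_mul (sq_nonneg c), Real.sqrt_sq hc]

variable [DecidableEq ι]

/-- The average over all choices of signs. -/
noncomputable def avg (F : (ι → Bool) → ℝ) : ℝ := (2 ^ Fintype.card ι : ℝ)⁻¹ * ∑ w, F w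

theorem avg_mono {F G : (ι → Bool) → ℝ} (h : ∀ w, F w ≤ G w) : avg F ≤ avg G := by
  unfold avg
  gcongr
  exact h _

theorem avg_nonneg {F : (ι → Bool) → ℝ} (h : ∀ w, 0 ≤ F w) : 0 ≤ avg F :=
  mul_nonneg (by positivity) (Finset.sum_nonneg fun w _ => h w)

theorem avg_const (c : ℝ) : avg (fun _ : ι → Bool => c) = c := by
  simp [avg]

theorem avg_mul_left (c : ℝ) (F : (ι → Bool) → ℝ) : avg (fun w => c * F w) = c * avg F := by
  simp only [avg, ← Finset.mul_sum]; ring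

theorem avg_add (F G : (ι → Bool) → ℝ) : avg (fun w => F w + G w) = avg F + avg G := by
  simp only [avg, Finset.sum_add_distrib]; ring

theorem avg_sum {κ : Type*} (s : Finset κ) (F : κ → (ι → Bool) → ℝ) :
    avg (fun w => ∑ k ∈ s, F k w) = ∑ k ∈ s, avg (F k) := by
  simp only [avg, ← Finset.mul_sum]
  rw [Finset.sum_comm]

theorem exists_le_avg (F : (ι → Bool) → ℝ) : ∃ w, F w ≤ avg F := by
  by_contra! h
  have h1 : ∑ w : ι → Bool, avg F < ∑ w, F w :=
    Finset.sum_lt_sum_of_nonempty Finset.univ_nonempty fun w _ => h w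
  rw [Finset.sum_const, Finset.card_univ, nsmul_eq_mul, avg] at h1
  simp at h1

/-- Jensen's inequality for the average over signs. -/
theorem avg_rpow_le {F : (ι → Bool) → ℝ} (hF : ∀ w, 0 ≤ F w) {t : ℝ} (ht : 1 ≤ t) :
    avg F ^ t ≤ avg (fun w => F w ^ t) := by
  have h := Real.rpow_arith_mean_le_arith_mean_rpow Finset.univ
    (fun _ : ι → Bool => (2 ^ Fintype.card ι : ℝ)⁻¹) F (fun _ _ => by positivity) (by simp)
    (fun w _ => hF w) ht
  simpa only [avg, Finset.mul_sum] using h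

/-- Hölder's inequality for the average over signs. -/
theorem avg_mul_le {F G : (ι → Bool) → ℝ} (hF : ∀ w, 0 ≤ F w) (hG : ∀ w, 0 ≤ G w) {r r' : ℝ}
    (hr : r.HolderConjugate r') : avg (fun w => F w * G w) ≤
      avg (fun w => F w ^ r) ^ (1 / r) * avg (fun w => G w ^ r') ^ (1 / r') := by
  set N : ℝ := (2 ^ Fintype.card ι : ℝ)⁻¹ with hN
  have hN0 : 0 < N := by positivity
  have h := Real.inner_le_Lp_mul_Lq_of_nonneg (s := Finset.univ) (f := fun w => N ^ (1 / r) * F w)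
    (g := fun w => N ^ (1 / r') * G w) hr
    (fun w _ => mul_nonneg (by positivity) (hF w)) (fun w _ => mul_nonneg (by positivity) (hG w))
  have e1 : ∀ w, (N ^ (1 / r) * F w) ^ r = N * F w ^ r := fun w => by
    rw [Real.mul_rpow (by positivity) (hF w), ← Real.rpow_mul hN0.le,
      one_div_mul_cancel hr.ne_zero, Real.rpow_one]
  have e2 : ∀ w, (N ^ (1 / r') * G w) ^ r' = N * G w ^ r' := fun w => by
    rw [Real.mul_rpow (by positivity) (hG w), ← Real.rpow_mul hN0.le,
      one_div_mul_cancel hr.symm.ne_zero, Real.rpow_one]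
  have e3 : ∀ w, N ^ (1 / r) * F w * (N ^ (1 / r') * G w) = N * (F w * G w) := fun w => by
    have : N ^ (1 / r) * N ^ (1 / r') = N := by
      rw [← Real.rpow_add hN0, hr.one_div_add_one_div, one_div_one, Real.rpow_one]
    calc _ = N ^ (1 / r) * N ^ (1 / r') * (F w * G w) := by ring
      _ = _ := by rw [this]
  simp only [e1, e2, e3, ← Finset.mul_sum] at h
  exact h

theorem avg_sgn_mul_sgn (i j : ι) :
    avg (fun w => sgn (w i) * sgn (w j)) = if i = j then 1 else 0 := by
  split_ifs with h
  · subst h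
    simp [sgn_mul_self, avg_const]
  · rw [avg, mul_eq_zero]
    right
    refine Finset.sum_involution (fun w _ => Function.update w i (!w i)) ?_ ?_ ?_ ?_
    · intro w _
      rw [Function.update_self, Function.update_of_ne (Ne.symm h)]
      cases w i <;> cases w j <;> simp [sgn]
    · intro w _ _ hw
      have := congrFun hw i
      simp at this
    · simp
    · intro w _
      simp

theorem avg_rad_sq (a : ι → ℝ) : avg (fun w => rad a w ^ 2) = eucl a ^ 2 := by
  have h : ∀ w : ι → Bool, rad a w ^ 2 =
      ∑ i, ∑ j, a i * a j * (sgn (w i) * sgn (w j)) := fun w => by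
    rw [sq, rad, Finset.sum_mul_sum]
    exact Finset.sum_congr rfl fun i _ => Finset.sum_congr rfl fun j _ => by ring
  simp only [h, avg_sum, avg_mul_left, avg_sgn_mul_sgn, eucl_sq]
  refine Finset.sum_congr rfl fun i _ => ?_
  simp [sq]

theorem avg_exp_rad_le (a : ι → ℝ) : avg (fun w => Real.exp (rad a w)) ≤
    Real.exp (eucl a ^ 2 / 2) := by
  have h : ∑ w : ι → Bool, Real.exp (rad a w) = ∏ i, (2 * Real.cosh (a i)) := by
    have h1 : ∀ i, 2 * Real.cosh (a i) = ∑ b : Bool, Real.exp (a i * sgn b) := fun i => by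
      rw [Fintype.sum_bool, Real.cosh_eq]; simp [sgn]; ring
    simp only [h1, Finset.prod_univ_sum, Fintype.piFinset_univ, rad, Real.exp_sum]
  rw [avg, h, Finset.prod_mul_distrib, Finset.prod_const, Finset.card_univ, ← mul_assoc,
    inv_mul_cancel₀ (by positivity), one_mul, eucl_sq, Finset.sum_div, Real.exp_sum]
  exact Finset.prod_le_prod (fun i _ => (Real.cosh_pos _).le)
    fun i _ => Real.cosh_le_exp_half_sq _

/-- The constant in the upper Khintchine inequality. -/
noncomputable def khC (q : ℝ) : ℝ := 2 * q ^ q * Real.exp (1 / 2)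

theorem khC_pos {q : ℝ} (hq : 0 < q) : 0 < khC q := by
  unfold khC; positivity

/-- Khintchine's upper inequality. For `eucl a = 1` the power `|x| ^ q` is dominated by a multiple
of `exp x + exp (-x)`, and the exponential moments of a Rademacher sum factor. -/
theorem avg_abs_rad_rpow_le {q : ℝ} (hq : 0 < q) (a : ι → ℝ) :
    avg (fun w => |rad a w| ^ q) ≤ khC q * eucl a ^ q := by
  have key : ∀ b : ι → ℝ, eucl b = 1 → avg (fun w => |rad b w| ^ q) ≤ khC q := by
    intro b hb
    have hpt : ∀ t : ℝ, |t| ^ q ≤ q ^ q * (Real.exp t + Real.exp (-t)) := by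
      intro t
      have h1 : |t| ≤ q * Real.exp (|t| / q) := by
        have := Real.add_one_le_exp (|t| / q)
        rw [← div_le_iff₀' hq]
        linarith
      have h2 : |t| ^ q ≤ q ^ q * Real.exp |t| := by
        refine (Real.rpow_le_rpow (abs_nonneg t) h1 hq.le).trans_eq ?_
        rw [Real.mul_rpow hq.le (Real.exp_pos _).le, ← Real.exp_mul, div_mul_cancel₀ _ hq.ne']
      refine h2.trans ?_
      gcongr
      rcases abs_cases t with ⟨h, -⟩ | ⟨h, -⟩ <;> rw [h] <;>
        linarith [Real.exp_pos t, Real.exp_pos (-t)]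
    have hb' : eucl (fun i => -b i) = 1 := by simpa [eucl] using hb
    have h1 := avg_exp_rad_le b
    have h2 := avg_exp_rad_le fun i => -b i
    simp only [rad_neg, hb'] at h2
    rw [hb] at h1
    calc avg (fun w => |rad b w| ^ q)
        ≤ avg (fun w => q ^ q * (Real.exp (rad b w) + Real.exp (-rad b w))) :=
          avg_mono fun w => hpt _
      _ = q ^ q * (avg (fun w => Real.exp (rad b w)) + avg fun w => Real.exp (-rad b w)) := by
          rw [avg_mul_left, avg_add]
      _ ≤ q ^ q * (Real.exp (1 ^ 2 / 2) + Real.exp (1 ^ 2 / 2)) := by gcongr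
      _ = khC q := by rw [khC, one_pow]; ring
  rcases (eucl_nonneg a).eq_or_lt with h0 | h0
  · have ha := eucl_eq_zero h0.symm
    simp [ha, rad, eucl, avg, Real.zero_rpow hq.ne']
  · have h1 := key (fun i => (eucl a)⁻¹ * a i) (by
      rw [eucl_smul (by positivity), inv_mul_cancel₀ h0.ne'])
    have h2 : ∀ w, |rad (fun i => (eucl a)⁻¹ * a i) w| ^ q =
        (eucl a ^ q)⁻¹ * |rad a w| ^ q := fun w => by
      rw [rad_smul, abs_mul, abs_of_pos (by positivity),
        Real.mul_rpow (by positivity) (abs_nonneg _), Real.inv_rpow h0.le]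
    simp only [h2, avg_mul_left] at h1
    rwa [inv_mul_le_iff₀ (by positivity), mul_comm] at h1

theorem avg_abs_rad_rpow_le_of_le_two {r : ℝ} (hr : 0 < r) (hr2 : r ≤ 2) (a : ι → ℝ) :
    avg (fun w => |rad a w| ^ r) ≤ eucl a ^ r := by
  have h := avg_rpow_le (F := fun w => |rad a w| ^ r) (fun w => by positivity)
    (t := 2 / r) ((one_le_div hr).2 hr2)
  simp only [← Real.rpow_mul (abs_nonneg _), mul_div_cancel₀ _ hr.ne', Real.rpow_ofNat, sq_abs,
    avg_rad_sq] at h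
  have h0 : 0 ≤ avg (fun w => |rad a w| ^ r) := avg_nonneg fun w => by positivity
  have h1 := Real.rpow_le_rpow (by positivity) h (div_nonneg hr.le two_pos.le)
  rw [← Real.rpow_mul h0, div_mul_div_cancel₀ hr.ne', div_self two_ne_zero, Real.rpow_one,
    ← Real.rpow_natCast, ← Real.rpow_mul (eucl_nonneg a),
    Nat.cast_ofNat, mul_div_cancel₀ _ two_ne_zero] at h1
  exact h1

theorem eucl_rpow_le_avg_of_two_le {q : ℝ} (hq : 2 ≤ q) (a : ι → ℝ) :
    eucl a ^ q ≤ avg (fun w => |rad a w| ^ q) := by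
  have h := avg_rpow_le (F := fun w => |rad a w| ^ (2 : ℝ)) (fun w => by positivity)
    (t := q / 2) (by linarith)
  simp only [← Real.rpow_mul (abs_nonneg _)] at h
  simp only [Real.rpow_ofNat, sq_abs, avg_rad_sq] at h
  rw [← Real.rpow_natCast, ← Real.rpow_mul (eucl_nonneg a)] at h
  simpa [mul_div_cancel₀] using h

/-- Khintchine's lower inequality, from the upper one for the conjugate exponent. -/
theorem exists_eucl_rpow_le_avg {r : ℝ} (hr : 1 < r) : ∃ C : ℝ, 0 < C ∧
    ∀ (κ : Type) [Fintype κ] [DecidableEq κ] (a : κ → ℝ),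
      eucl a ^ r ≤ C * avg (fun w => |rad a w| ^ r) := by
  have hc := Real.HolderConjugate.conjExponent hr
  set r' := Real.conjExponent r with hr'
  have hK := khC_pos hc.symm.pos
  refine ⟨(khC r' ^ (1 / r')) ^ r, by positivity, fun κ _ _ a => ?_⟩
  set D := avg (fun w => |rad a w| ^ r) with hD
  have hD0 : 0 ≤ D := avg_nonneg fun w => by positivity
  rcases (eucl_nonneg a).eq_or_lt with h0 | h0
  · rw [← h0, Real.zero_rpow (by linarith)]
    positivity
  have h1 : eucl a ^ 2 ≤ D ^ (1 / r) * (khC r' ^ (1 / r') * eucl a) := by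
    have h2 := avg_mul_le (F := fun w => |rad a w|) (G := fun w => |rad a w|)
      (fun w => abs_nonneg _) (fun w => abs_nonneg _) hc
    simp only [← sq, sq_abs, avg_rad_sq] at h2
    refine h2.trans ?_
    gcongr
    have h3 := Real.rpow_le_rpow (avg_nonneg fun w => by positivity)
      (avg_abs_rad_rpow_le hc.symm.pos a) hc.symm.one_div_nonneg
    rwa [Real.mul_rpow hK.le (by positivity), ← Real.rpow_mul (eucl_nonneg a),
      mul_one_div_cancel hc.symm.ne_zero, Real.rpow_one] at h3
  have h4 : eucl a ≤ khC r' ^ (1 / r') * D ^ (1 / r) := by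
    have : eucl a * eucl a ≤ (khC r' ^ (1 / r') * D ^ (1 / r)) * eucl a := by
      rw [← sq]; linarith
    exact le_of_mul_le_mul_right this h0
  have h5 := Real.rpow_le_rpow h0.le h4 (by linarith : 0 ≤ r)
  rwa [Real.mul_rpow (by positivity) (by positivity), ← Real.rpow_mul hD0,
    one_div_mul_cancel hc.ne_zero, Real.rpow_one] at h5

end Khintchine

/-! ### Formal inclusions are finitely strictly singular -/

theorem sum_sq_le_norm_sq (x : Ell 2) (s : Finset ℕ) : ∑ k ∈ s, x k ^ 2 ≤ ‖x‖ ^ 2 := by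
  have := lp.sum_rpow_le_norm_rpow (p := 2) (by simp) x s
  simpa using this

theorem ell_sum_apply {p : ℝ≥0∞} {κ : Type*} (s : Finset κ) (c : κ → ℝ) (f : κ → Ell p) (k : ℕ) :
    (∑ i ∈ s, c i • f i : Ell p) k = ∑ i ∈ s, c i * f i k := by
  rw [lp.coeFn_sum, Finset.sum_apply]
  rfl

/-- Subspaces of `ℓ_2` of large dimension contain vectors with small coordinates. A random signed
sum of an orthonormal basis of an `n`-dimensional subspace has norm `√n`, while the sum of the
fourth powers of its coordinates is of order `n` in the mean. -/
theorem exists_flat_vector {ε : ℝ} (hε : 0 < ε) : ∃ n : ℕ, 0 < n ∧ ∀ E : Submodule ℝ (Ell 2),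
    n ≤ Module.finrank ℝ E → ∃ x ∈ E, x ≠ 0 ∧ ∀ k, |x k| ≤ ε * ‖x‖ := by
  obtain ⟨n, hn⟩ := exists_nat_gt (khC 4 / ε ^ 4)
  have hK := khC_pos (q := 4) (by norm_num)
  have hn0 : 0 < n := by
    have : (0 : ℝ) < n := lt_of_le_of_lt (by positivity) hn
    exact_mod_cast this
  refine ⟨n, hn0, fun E hE => ?_⟩
  obtain ⟨F, hFE, hF⟩ := exists_le_finrank_eq E hE
  have hfin : FiniteDimensional ℝ F := FiniteDimensional.of_finrank_pos (by omega)
  let u := (stdOrthonormalBasis ℝ F).reindex (finCongr hF)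
  let x : (Fin n → ℝ) → F := fun a => ∑ i, a i • u i
  have hxn : ∀ a, ‖(x a : Ell 2)‖ = eucl a := fun a => by
    have h := u.sum_sq_norm_inner_right (x a)
    have h1 : ∀ i, inner ℝ (u i) (x a) = a i := fun i => by
      simp [x, inner_sum, inner_smul_right, orthonormal_iff_ite.1 u.orthonormal]
    simp only [h1, Real.norm_eq_abs, sq_abs] at h
    rw [eucl, h, Submodule.coe_norm, Real.sqrt_sq (norm_nonneg _)]
  have hxk : ∀ a k, (x a : Ell 2) k = ∑ i, a i * (u i : Ell 2) k := fun a k => by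
    simp only [x, Submodule.coe_sum, Submodule.coe_smul]
    exact ell_sum_apply _ _ _ _
  have hU1 : ∀ k, eucl (fun i => (u i : Ell 2) k) ≤ 1 := fun k => by
    set a : Fin n → ℝ := fun i => (u i : Ell 2) k with ha
    have h1 : eucl a ^ 2 ≤ eucl a := by
      calc eucl a ^ 2 = (x a : Ell 2) k := by
            rw [hxk, eucl_sq]; exact Finset.sum_congr rfl fun i _ => by rw [sq]
        _ ≤ ‖(x a : Ell 2) k‖ := le_abs_self _
        _ ≤ ‖(x a : Ell 2)‖ := lp.norm_apply_le_norm (by norm_num) _ _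
        _ = eucl a := hxn a
    nlinarith [eucl_nonneg a]
  have hU2 : ∀ s : Finset ℕ, ∑ k ∈ s, eucl (fun i => (u i : Ell 2) k) ^ 2 ≤ n := fun s => by
    simp only [eucl_sq]
    rw [Finset.sum_comm]
    calc ∑ i, ∑ k ∈ s, (u i : Ell 2) k ^ 2 ≤ ∑ i : Fin n, 1 := by
          refine Finset.sum_le_sum fun i _ => (sum_sq_le_norm_sq _ s).trans ?_
          rw [← Submodule.coe_norm, u.orthonormal.1 i, one_pow]
      _ = n := by simp
  have hsn : ∀ w : Fin n → Bool, eucl (fun i => sgn (w i)) = √n := fun w => by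
    rw [eucl_sgn, Fintype.card_fin]
  by_contra! hcon
  have hex : ∀ w : Fin n → Bool, ∃ k, ε * √n < |(x fun i => sgn (w i) : Ell 2) k| := fun w => by
    obtain ⟨k, hk⟩ := hcon (x fun i => sgn (w i)) (hFE (x _).2) (by
      intro h0
      have := hxn fun i => sgn (w i)
      rw [h0, norm_zero, hsn] at this
      have h2 : 0 < √(n : ℝ) := by positivity
      linarith)
    exact ⟨k, by rwa [hxn, hsn] at hk⟩
  choose k hk using hex
  let s := Finset.univ.image k
  have havg : avg (fun w : Fin n → Bool => ∑ j ∈ s, |rad (fun i => (u i : Ell 2) j) w| ^ (4 : ℝ)) ≤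
      khC 4 * n := by
    rw [avg_sum]
    calc _ ≤ ∑ j ∈ s, khC 4 * eucl (fun i => (u i : Ell 2) j) ^ (4 : ℝ) :=
          Finset.sum_le_sum fun j _ => avg_abs_rad_rpow_le (by norm_num) _
      _ ≤ ∑ j ∈ s, khC 4 * eucl (fun i => (u i : Ell 2) j) ^ 2 := by
          refine Finset.sum_le_sum fun j _ => ?_
          gcongr
          rw [Real.rpow_ofNat]
          exact pow_le_pow_of_le_one (eucl_nonneg _) (hU1 j) (by norm_num)
      _ ≤ khC 4 * n := by
          rw [← Finset.mul_sum]
          gcongr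
          exact hU2 s
  obtain ⟨w, hw⟩ := exists_le_avg
    (fun w : Fin n → Bool => ∑ j ∈ s, |rad (fun i => (u i : Ell 2) j) w| ^ (4 : ℝ))
  have h1 : (ε * √n) ^ 4 ≤ khC 4 * n := by
    calc (ε * √n) ^ 4 ≤ |rad (fun i => (u i : Ell 2) (k w)) w| ^ 4 := by
          have := hk w
          rw [hxk] at this
          simp only [rad, mul_comm _ (sgn _)]
          gcongr
      _ = |rad (fun i => (u i : Ell 2) (k w)) w| ^ (4 : ℝ) := by rw [Real.rpow_ofNat]
      _ ≤ ∑ j ∈ s, |rad (fun i => (u i : Ell 2) j) w| ^ (4 : ℝ) :=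
          Finset.single_le_sum (f := fun j => |rad (fun i => (u i : Ell 2) j) w| ^ (4 : ℝ))
            (fun j _ => by positivity) (Finset.mem_image_of_mem k (Finset.mem_univ w))
      _ ≤ khC 4 * n := hw.trans havg
  have h2 : (ε * √n) ^ 4 = ε ^ 4 * n * n := by
    rw [mul_pow, show √(n : ℝ) ^ 4 = (√(n : ℝ) ^ 2) ^ 2 by ring, Real.sq_sqrt (by positivity)]
    ring
  rw [h2] at h1
  rw [div_lt_iff₀ (by positivity)] at hn
  have h3 : (0 : ℝ) < n := by exact_mod_cast hn0
  have h4 := le_of_mul_le_mul_right h1 h3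
  linarith

theorem norm_formalInclusion_le_of_flat {p s : ℝ≥0∞} [Fact (1 ≤ p)] [Fact (1 ≤ s)] (h : p ≤ s)
    (hs : s ≠ ∞) {x : Ell p} {δ : ℝ} (hδ : 0 ≤ δ) (hx : ∀ k, |x k| ≤ δ * ‖x‖) :
    ‖formalInclusion p s h x‖ ≤ δ ^ (1 - p.toReal / s.toReal) * ‖x‖ := by
  have hp0 : p ≠ 0 := (zero_lt_one.trans_le (Fact.out : 1 ≤ p)).ne'
  have hp : p ≠ ∞ := ne_top_of_le_ne_top hs h
  have hP : 0 < p.toReal := ENNReal.toReal_pos hp0 hp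
  have hPS : p.toReal ≤ s.toReal := ENNReal.toReal_mono hs h
  have hS : 0 < s.toReal := hP.trans_le hPS
  have hn := norm_nonneg x
  refine lp.norm_le_of_forall_sum_le hS (by positivity) fun F => ?_
  have hsplit : ∀ a : ℝ, 0 ≤ a → a ^ s.toReal = a ^ (s.toReal - p.toReal) * a ^ p.toReal := by
    intro a ha
    rw [← Real.rpow_add_of_nonneg ha (sub_nonneg.2 hPS) hP.le, sub_add_cancel]
  calc ∑ k ∈ F, ‖formalInclusion p s h x k‖ ^ s.toReal
      ≤ ∑ k ∈ F, (δ * ‖x‖) ^ (s.toReal - p.toReal) * ‖x k‖ ^ p.toReal := by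
        refine Finset.sum_le_sum fun k _ => ?_
        rw [formalInclusion_apply, hsplit _ (norm_nonneg _)]
        gcongr
        exact hx k
    _ ≤ (δ * ‖x‖) ^ (s.toReal - p.toReal) * ‖x‖ ^ p.toReal := by
        rw [← Finset.mul_sum]
        have := lp.sum_rpow_le_norm_rpow hP x F
        gcongr
    _ = (δ ^ (1 - p.toReal / s.toReal) * ‖x‖) ^ s.toReal := by
        rw [Real.mul_rpow hδ hn, mul_assoc, ← hsplit _ hn, Real.mul_rpow (by positivity) hn,
          ← Real.rpow_mul hδ, sub_mul, div_mul_cancel₀ _ hS.ne', one_mul]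

theorem fss_formalInclusion {p s : ℝ≥0∞} [Fact (1 ≤ p)] [Fact (1 ≤ s)] (hp2 : p ≤ 2) (h : p < s)
    (hs : s ≠ ∞) : FinitelyStrictlySingular (formalInclusion p s h.le) := by
  rw [finitelyStrictlySingular_iff]
  intro ε hε
  have hp0 : p ≠ 0 := (zero_lt_one.trans_le (Fact.out : 1 ≤ p)).ne'
  have hP : 0 < p.toReal := ENNReal.toReal_pos hp0 h.ne_top
  have hPS : p.toReal < s.toReal := (ENNReal.toReal_lt_toReal h.ne_top hs).2 h
  have hS : 0 < s.toReal := hP.trans hPS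
  have hθ : 0 < 1 - p.toReal / s.toReal := by rw [sub_pos, div_lt_one hS]; exact hPS
  obtain ⟨n, hn0, hn⟩ := exists_flat_vector (ε := ε ^ (1 - p.toReal / s.toReal)⁻¹) (by positivity)
  refine ⟨n, hn0, fun E hE => ?_⟩
  let J := (formalInclusion p 2 hp2).toLinearMap
  have hJ : Function.Injective J := fun x y hxy => by
    ext k
    exact congrFun (congrArg (fun z : Ell 2 => (z : ℕ → ℝ)) hxy) k
  have hr : n ≤ Module.finrank ℝ (E.map J) := by
    rwa [← (Submodule.equivMapOfInjective J hJ E).finrank_eq]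
  obtain ⟨_, ⟨x, hx, rfl⟩, hx0, hxk⟩ := hn _ hr
  refine ⟨x, hx, fun h0 => hx0 (by rw [h0, map_zero]), ?_⟩
  have hle : ‖J x‖ ≤ ‖x‖ := norm_linearMapOfLE_le hp2 x
  have := norm_formalInclusion_le_of_flat h.le hs (x := x)
    (δ := ε ^ (1 - p.toReal / s.toReal)⁻¹) (by positivity) fun k => (hxk k).trans (by gcongr)
  rwa [← Real.rpow_mul hε.le, inv_mul_cancel₀ hθ.ne', Real.rpow_one] at this

/-! ### Block diagonal operators between sequence spaces -/

section Blocks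

/-- The `ℓ_r` norm of a finite family of reals. -/
noncomputable def lpn {κ : Type*} [Fintype κ] (r : ℝ) (u : κ → ℝ) : ℝ := (∑ j, |u j| ^ r) ^ (1 / r)

theorem lpn_nonneg {κ : Type*} [Fintype κ] (r : ℝ) (u : κ → ℝ) : 0 ≤ lpn r u := by
  unfold lpn; positivity

theorem lpn_rpow {κ : Type*} [Fintype κ] {r : ℝ} (hr : 0 < r) (u : κ → ℝ) :
    lpn r u ^ r = ∑ j, |u j| ^ r := by
  rw [lpn, ← Real.rpow_mul (by positivity), one_div_mul_cancel hr.ne', Real.rpow_one]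

theorem lpn_le_iff {κ : Type*} [Fintype κ] {r : ℝ} (hr : 0 < r) (u : κ → ℝ) {c : ℝ} (hc : 0 ≤ c) :
    lpn r u ≤ c ↔ ∑ j, |u j| ^ r ≤ c ^ r := by
  rw [← lpn_rpow hr, Real.rpow_le_rpow_iff (lpn_nonneg r u) hc hr]

theorem lpn_two {κ : Type*} [Fintype κ] (u : κ → ℝ) : lpn 2 u = eucl u := by
  rw [lpn, eucl, Real.sqrt_eq_rpow]
  simp

theorem toReal_pos_of_one_le {p : ℝ≥0∞} [Fact (1 ≤ p)] (hp : p ≠ ∞) : 0 < p.toReal :=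
  ENNReal.toReal_pos (zero_lt_one.trans_le (Fact.out : 1 ≤ p)).ne' hp

variable (J I : ℕ → Type) [∀ n, Fintype (J n)] [∀ n, Fintype (I n)]

/-- An injective numbering of the disjoint union of countably many finite blocks, fixing pairwise
disjoint copies of the blocks inside `ℕ`. -/
noncomputable def idx (z : Σ n, J n) : ℕ := (exists_injective_nat (Σ n, J n)).choose z

theorem idx_injective : Function.Injective (idx J) :=
  (exists_injective_nat (Σ n, J n)).choose_spec

variable {J I}

theorem sum_blocks_le {p : ℝ≥0∞} [Fact (1 ≤ p)] (hp : p ≠ ∞) (x : Ell p) (N : Finset ℕ) :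
    ∑ n ∈ N, ∑ j, |x (idx J ⟨n, j⟩)| ^ p.toReal ≤ ‖x‖ ^ p.toReal := by
  classical
  rw [← Finset.sum_sigma (f := fun z : Σ n, J n => |x (idx J z)| ^ p.toReal),
    ← Finset.sum_image (f := fun k => |x k| ^ p.toReal) (g := idx J) (idx_injective J).injOn]
  exact lp.sum_rpow_le_norm_rpow (toReal_pos_of_one_le hp) x _

theorem lpn_block_le {p : ℝ≥0∞} [Fact (1 ≤ p)] (hp : p ≠ ∞) (x : Ell p) (n : ℕ) :
    lpn p.toReal (fun j => x (idx J ⟨n, j⟩)) ≤ ‖x‖ := by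
  rw [lpn_le_iff (toReal_pos_of_one_le hp) _ (norm_nonneg x)]
  simpa using sum_blocks_le (J := J) hp x {n}

/-- Uniformly bounded matrices `M n : ℓ_r(J n) → ℓ_s(I n)` with `r ≤ s` assemble to a bounded
operator `ℓ_r → ℓ_s`, acting as `M n` from the `n`-th block of `J` to the `n`-th block of `I`. -/
theorem exists_block_operator {r s : ℝ≥0∞} [Fact (1 ≤ r)] [Fact (1 ≤ s)] (hrs : r ≤ s)
    (hs : s ≠ ∞) (M : ∀ n, I n → J n → ℝ) {C : ℝ} (hC : 0 ≤ C)
    (hM : ∀ n u, lpn s.toReal (fun i => ∑ j, M n i j * u j) ≤ C * lpn r.toReal u) :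
    ∃ T : Ell r →L[ℝ] Ell s, ∀ x n i, T x (idx I ⟨n, i⟩) = ∑ j, M n i j * x (idx J ⟨n, j⟩) := by
  classical
  have hr : r ≠ ∞ := ne_top_of_le_ne_top hs hrs
  have hR := toReal_pos_of_one_le hr
  have hRS : r.toReal ≤ s.toReal := ENNReal.toReal_mono hs hrs
  have hS := hR.trans_le hRS
  let g : Ell r → (Σ n, I n) → ℝ := fun x z => ∑ j, M z.1 z.2 j * x (idx J ⟨z.1, j⟩)
  let f : Ell r → ℕ → ℝ := fun x => Function.extend (idx I) (g x) 0
  have hf1 : ∀ x z, f x (idx I z) = g x z := fun x z => (idx_injective I).extend_apply _ _ _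
  have hf0 : ∀ x k, k ∉ Set.range (idx I) → f x k = 0 := fun x k hk =>
    Function.extend_apply' _ _ _ hk
  have hbound : ∀ x (F : Finset ℕ), ∑ k ∈ F, ‖f x k‖ ^ s.toReal ≤ (C * ‖x‖) ^ s.toReal := by
    intro x F
    have hsplit : ∀ a : ℝ, 0 ≤ a →
        a ^ s.toReal = a ^ (s.toReal - r.toReal) * a ^ r.toReal := by
      intro a ha
      rw [← Real.rpow_add_of_nonneg ha (sub_nonneg.2 hRS) hR.le, sub_add_cancel]
    let G := F.preimage (idx I) (idx_injective I).injOn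
    let N := G.image Sigma.fst
    have hn := norm_nonneg x
    calc ∑ k ∈ F, ‖f x k‖ ^ s.toReal = ∑ z ∈ G, ‖f x (idx I z)‖ ^ s.toReal := by
          rw [Finset.sum_preimage (idx I) F (idx_injective I).injOn
            (fun k => ‖f x k‖ ^ s.toReal)]
          intro k _ hk
          rw [hf0 x k hk, norm_zero, Real.zero_rpow hS.ne']
      _ = ∑ z ∈ G, |g x z| ^ s.toReal := by simp only [hf1, Real.norm_eq_abs]
      _ ≤ ∑ z ∈ N.sigma fun _ => Finset.univ, |g x z| ^ s.toReal := by
          refine Finset.sum_le_sum_of_subset_of_nonneg (fun z hz => ?_) fun _ _ _ => by positivity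
          simp only [Finset.mem_sigma, Finset.mem_univ, and_true]
          exact Finset.mem_image_of_mem _ hz
      _ = ∑ n ∈ N, lpn s.toReal (fun i => g x ⟨n, i⟩) ^ s.toReal := by
          rw [Finset.sum_sigma]
          exact Finset.sum_congr rfl fun n _ => (lpn_rpow hS _).symm
      _ ≤ ∑ n ∈ N, C ^ s.toReal * (‖x‖ ^ (s.toReal - r.toReal) *
            ∑ j, |x (idx J ⟨n, j⟩)| ^ r.toReal) := by
          refine Finset.sum_le_sum fun n _ => ?_
          have h1 := hM n fun j => x (idx J ⟨n, j⟩)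
          have h2 := lpn_nonneg r.toReal fun j => x (idx J ⟨n, j⟩)
          refine (Real.rpow_le_rpow (lpn_nonneg _ _) h1 hS.le).trans ?_
          rw [Real.mul_rpow hC h2, hsplit _ h2, lpn_rpow hR]
          gcongr
          exact lpn_block_le hr x n
      _ ≤ C ^ s.toReal * (‖x‖ ^ (s.toReal - r.toReal) * ‖x‖ ^ r.toReal) := by
          rw [← Finset.mul_sum, ← Finset.mul_sum]
          gcongr
          exact sum_blocks_le hr x N
      _ = (C * ‖x‖) ^ s.toReal := by rw [← hsplit _ hn, Real.mul_rpow hC hn]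
  have hg : ∀ x y c z, g (c • x + y) z = c * g x z + g y z := fun x y c z => by
    simp only [g, Finset.mul_sum, ← Finset.sum_add_distrib]
    refine Finset.sum_congr rfl fun j _ => ?_
    rw [lp.coeFn_add, lp.coeFn_smul, Pi.add_apply, Pi.smul_apply, smul_eq_mul]
    ring
  have hlin : ∀ x y (c : ℝ) k, f (c • x + y) k = c * f x k + f y k := fun x y c k => by
    by_cases hk : k ∈ Set.range (idx I)
    · obtain ⟨z, rfl⟩ := hk
      simp only [hf1, hg]
    · simp only [hf0 _ k hk]; ring
  have hf_zero : ∀ k, f 0 k = 0 := fun k => by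
    have := hlin 0 0 1 k
    simp only [smul_zero, add_zero] at this
    linarith
  let T : Ell r →ₗ[ℝ] Ell s :=
    { toFun := fun x => ⟨f x, memℓp_gen' (hbound x)⟩
      map_add' := fun x y => by
        ext k
        have := hlin x y 1 k
        rw [one_smul, one_mul] at this
        exact this
      map_smul' := fun c x => by
        ext k
        have := hlin x 0 c k
        rw [add_zero, hf_zero, add_zero] at this
        exact this }
  refine ⟨T.mkContinuous C fun x => ?_, fun x n i => hf1 x ⟨n, i⟩⟩
  exact lp.norm_le_of_forall_sum_le hS (by positivity) (hbound x)

/-- The vector of `ℓ_p` supported on the `n`-th block with the coordinates `u`. -/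
noncomputable def blockVec (p : ℝ≥0∞) [Fact (1 ≤ p)] (n : ℕ) (u : J n → ℝ) : Ell p :=
  ∑ j, u j • lp.single p (idx J ⟨n, j⟩) (1 : ℝ)

theorem blockVec_apply (p : ℝ≥0∞) [Fact (1 ≤ p)] (n : ℕ) (u : J n → ℝ) (j : J n) :
    blockVec p n u (idx J ⟨n, j⟩) = u j := by
  classical
  rw [blockVec, ell_sum_apply, Finset.sum_eq_single j]
  · rw [lp.single_apply_self, mul_one]
  · intro i _ hij
    rw [lp.single_apply_ne, mul_zero]
    intro h
    have := idx_injective J h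
    simp at this
    exact hij this.symm
  · simp

theorem norm_blockVec {p : ℝ≥0∞} [Fact (1 ≤ p)] (hp : p ≠ ∞) (n : ℕ) (u : J n → ℝ) :
    ‖blockVec p n u‖ = lpn p.toReal u := by
  classical
  have hP := toReal_pos_of_one_le hp
  have hinj : Function.Injective fun j : J n => idx J ⟨n, j⟩ := fun i j h => by
    simpa using idx_injective J h
  let v : ℕ → ℝ := fun k => blockVec p n u k
  have h1 : blockVec p n u = ∑ k ∈ Finset.univ.image fun j : J n => idx J ⟨n, j⟩,
      lp.single p k (v k) := by
    rw [Finset.sum_image hinj.injOn]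
    conv_lhs => rw [blockVec]
    refine Finset.sum_congr rfl fun j _ => ?_
    rw [← lp.single_smul, smul_eq_mul, mul_one]
    simp only [v, blockVec_apply]
  have h2 := lp.norm_sum_single hP v (Finset.univ.image fun j : J n => idx J ⟨n, j⟩)
  rw [← h1, Finset.sum_image hinj.injOn] at h2
  simp only [v, blockVec_apply, Real.norm_eq_abs] at h2
  rw [lpn, ← h2, ← Real.rpow_mul (norm_nonneg _), mul_one_div_cancel hP.ne', Real.rpow_one]

theorem blockVec_sum {κ : Type*} [Fintype κ] (p : ℝ≥0∞) [Fact (1 ≤ p)] (n : ℕ)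
    (c : κ → ℝ) (u : κ → J n → ℝ) :
    blockVec p n (fun j => ∑ i, c i * u i j) = ∑ i, c i • blockVec p n (u i) := by
  simp only [blockVec, Finset.smul_sum, Finset.sum_smul, smul_smul]
  exact Finset.sum_comm

/-- The functional on `ℓ_q` given by a finite combination `v` of the coordinates in the `n`-th
block. -/
noncomputable def blockFun (q : ℝ≥0∞) [Fact (1 ≤ q)] (n : ℕ) (v : I n → ℝ) : Ell q →L[ℝ] ℝ :=
  ∑ i, v i • lp.evalCLM ℝ (fun _ : ℕ => ℝ) q (idx I ⟨n, i⟩)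

theorem blockFun_apply (q : ℝ≥0∞) [Fact (1 ≤ q)] (n : ℕ) (v : I n → ℝ) (y : Ell q) :
    blockFun q n v y = ∑ i, v i * y (idx I ⟨n, i⟩) := by
  simp [blockFun]
  rfl

theorem blockFun_sum {κ : Type*} [Fintype κ] (q : ℝ≥0∞) [Fact (1 ≤ q)] (n : ℕ)
    (c : κ → ℝ) (v : κ → I n → ℝ) (y : Ell q) :
    blockFun q n (fun j => ∑ i, c i * v i j) y = ∑ i, c i * blockFun q n (v i) y := by
  simp only [blockFun_apply, Finset.mul_sum, Finset.sum_mul, mul_assoc]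
  exact Finset.sum_comm

theorem abs_blockFun_le {q : ℝ≥0∞} [Fact (1 ≤ q)] (hq : q ≠ ∞) {q' : ℝ}
    (hqq : q'.HolderConjugate q.toReal) (n : ℕ) (v : I n → ℝ) (y : Ell q) :
    |blockFun q n v y| ≤ lpn q' v * ‖y‖ := by
  rw [blockFun_apply]
  calc |∑ i, v i * y (idx I ⟨n, i⟩)| ≤ ∑ i, |v i| * |y (idx I ⟨n, i⟩)| := by
        simpa only [abs_mul] using
          Finset.abs_sum_le_sum_abs (fun i => v i * y (idx I ⟨n, i⟩)) Finset.univ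
    _ ≤ lpn q' v * lpn q.toReal (fun i => y (idx I ⟨n, i⟩)) := by
        simpa only [abs_abs, lpn] using Real.inner_le_Lp_mul_Lq Finset.univ (fun i => |v i|)
          (fun i => |y (idx I ⟨n, i⟩)|) hqq
    _ ≤ lpn q' v * ‖y‖ := by
        gcongr
        · exact lpn_nonneg _ _
        · exact lpn_block_le hq y n

end Blocks

/-! ### Rademacher systems in finite-dimensional `ℓ_r` spaces -/

theorem lpn_le_card_rpow_mul {κ : Type*} [Fintype κ] {r s : ℝ} (hr : 0 < r) (hrs : r ≤ s)
    (a : κ → ℝ) : lpn r a ≤ (Fintype.card κ : ℝ) ^ (1 / r - 1 / s) * lpn s a := by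
  have hs := hr.trans_le hrs
  have h := Real.rpow_sum_le_const_mul_sum_rpow Finset.univ (fun i => |a i| ^ r)
    ((one_le_div hr).2 hrs)
  have habs : ∀ i, |(|a i| ^ r)| = |a i| ^ r := fun i => abs_of_nonneg (by positivity)
  simp only [habs, ← Real.rpow_mul (abs_nonneg _), mul_div_cancel₀ _ hr.ne',
    Finset.card_univ] at h
  have h0 : 0 ≤ ∑ i, |a i| ^ r := by positivity
  have h1 := Real.rpow_le_rpow (by positivity) h (one_div_nonneg.2 hs.le)
  rw [← Real.rpow_mul h0, Real.mul_rpow (by positivity) (by positivity),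
    ← Real.rpow_mul (Nat.cast_nonneg _)] at h1
  have e1 : s / r * (1 / s) = 1 / r := by field_simp
  have e2 : (s / r - 1) * (1 / s) = 1 / r - 1 / s := by field_simp
  rwa [e1, e2] at h1

section Rademacher

variable {ι : Type} [Fintype ι]

/-- The `i`-th Rademacher function on `ι → Bool`, normalized in `ℓ_r`. -/
noncomputable def radCol (r : ℝ) (i : ι) (w : ι → Bool) : ℝ :=
  (2 ^ Fintype.card ι : ℝ) ^ (-(1 / r)) * sgn (w i)

theorem sum_mul_radCol (r : ℝ) (a : ι → ℝ) (w : ι → Bool) :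
    ∑ i, a i * radCol r i w = (2 ^ Fintype.card ι : ℝ) ^ (-(1 / r)) * rad a w := by
  simp only [radCol, rad, Finset.mul_sum]
  exact Finset.sum_congr rfl fun i _ => by ring

variable [DecidableEq ι]

theorem lpn_radCol_rpow {r : ℝ} (hr : 0 < r) (a : ι → ℝ) :
    lpn r (fun w => ∑ i, a i * radCol r i w) ^ r = avg fun w => |rad a w| ^ r := by
  rw [lpn_rpow hr, avg, Finset.mul_sum]
  refine Finset.sum_congr rfl fun w _ => ?_
  rw [sum_mul_radCol, abs_mul, abs_of_pos (by positivity), Real.mul_rpow (by positivity)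
    (abs_nonneg _), ← Real.rpow_mul (by positivity), neg_mul, one_div_mul_cancel hr.ne',
    Real.rpow_neg_one]

theorem lpn_radCol_le {r : ℝ} (hr : 0 < r) (a : ι → ℝ) :
    lpn r (fun w => ∑ i, a i * radCol r i w) ≤ khC r ^ (1 / r) * eucl a := by
  have hK := khC_pos hr
  have ha := eucl_nonneg a
  rw [← Real.rpow_le_rpow_iff (lpn_nonneg _ _) (by positivity) hr, lpn_radCol_rpow hr,
    Real.mul_rpow (by positivity) ha, ← Real.rpow_mul hK.le, one_div_mul_cancel hr.ne',
    Real.rpow_one]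
  exact avg_abs_rad_rpow_le hr a

theorem lpn_radCol_le_of_le_two {r : ℝ} (hr : 0 < r) (hr2 : r ≤ 2) (a : ι → ℝ) :
    lpn r (fun w => ∑ i, a i * radCol r i w) ≤ eucl a := by
  rw [← Real.rpow_le_rpow_iff (lpn_nonneg _ _) (eucl_nonneg a) hr, lpn_radCol_rpow hr]
  exact avg_abs_rad_rpow_le_of_le_two hr hr2 a

theorem eucl_le_lpn_radCol {q : ℝ} (hq : 2 ≤ q) (a : ι → ℝ) :
    eucl a ≤ lpn q (fun w => ∑ i, a i * radCol q i w) := by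
  have hq0 : 0 < q := by linarith
  rw [← Real.rpow_le_rpow_iff (eucl_nonneg a) (lpn_nonneg _ _) hq0, lpn_radCol_rpow hq0]
  exact eucl_rpow_le_avg_of_two_le hq a

theorem sum_ite_mul_radCol (r : ℝ) (i : ι) (w : ι → Bool) :
    ∑ j, (if j = i then 1 else 0) * radCol r j w = radCol r i w := by
  simp

theorem eucl_ite (i : ι) : eucl (fun j => if j = i then (1 : ℝ) else 0) = 1 := by
  simp [eucl]

theorem lpn_radCol_self_le {r : ℝ} (hr : 0 < r) (hr2 : r ≤ 2) (i : ι) :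
    lpn r (radCol r i) ≤ 1 := by
  have := lpn_radCol_le_of_le_two hr hr2 fun j => if j = i then (1 : ℝ) else 0
  simpa only [sum_ite_mul_radCol, eucl_ite] using this

/-- Biorthogonality of the Rademacher systems normalized in `ℓ_r` and in the dual space. -/
theorem sum_radCol_mul_radCol {r r' : ℝ} (h : r.HolderConjugate r') (i j : ι) :
    ∑ w, radCol r i w * radCol r' j w = if i = j then 1 else 0 := by
  rw [← avg_sgn_mul_sgn, avg, Finset.mul_sum]
  refine Finset.sum_congr rfl fun w _ => ?_
  have : (2 ^ Fintype.card ι : ℝ) ^ (-(1 / r)) * (2 ^ Fintype.card ι : ℝ) ^ (-(1 / r')) =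
      (2 ^ Fintype.card ι : ℝ)⁻¹ := by
    rw [← Real.rpow_add (by positivity), ← neg_add, h.one_div_add_one_div, one_div_one,
      Real.rpow_neg_one]
  rw [← this, radCol, radCol]
  ring

/-- The orthogonal projection onto the Rademacher system is bounded from `ℓ_r` to `ℓ_2`, dually to
Khintchine's inequality in `ℓ_{r'}`. -/
theorem eucl_radCol_le {r r' : ℝ} (h : r.HolderConjugate r') (u : (ι → Bool) → ℝ) :
    eucl (fun i => ∑ w, radCol r' i w * u w) ≤ khC r' ^ (1 / r') * lpn r u := by
  set b : ι → ℝ := fun i => ∑ w, radCol r' i w * u w with hb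
  have hK := khC_pos h.symm.pos
  have h1 : eucl b * eucl b ≤ khC r' ^ (1 / r') * lpn r u * eucl b := by
    calc eucl b * eucl b = ∑ w, (∑ i, b i * radCol r' i w) * u w := by
          rw [← sq, eucl_sq]
          simp only [Finset.sum_mul]
          rw [Finset.sum_comm]
          refine Finset.sum_congr rfl fun i _ => ?_
          simp only [mul_assoc, ← Finset.mul_sum]
          rw [sq]
      _ ≤ lpn r' (fun w => ∑ i, b i * radCol r' i w) * lpn r u :=
          Real.inner_le_Lp_mul_Lq _ _ _ h.symm
      _ ≤ khC r' ^ (1 / r') * eucl b * lpn r u := by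
          gcongr
          · exact lpn_nonneg _ _
          · exact lpn_radCol_le h.symm.pos b
      _ = _ := by ring
  rcases (eucl_nonneg b).eq_or_lt with h0 | h0
  · rw [← h0]
    have := lpn_nonneg r u
    positivity
  · exact le_of_mul_le_mul_right h1 h0

end Rademacher

/-! ### Pairings of functionals with vectors -/

/-- A functional of norm at most `D` on `ℓ_t` has values at the unit vectors of `ℓ_{t'}` norm at
most `D`. -/
theorem sum_functional_rpow_le {t : ℝ≥0∞} [Fact (1 ≤ t)] (ht : t ≠ ∞) {t' : ℝ}
    (h : t'.HolderConjugate t.toReal) (ψ : Ell t →L[ℝ] ℝ) {D : ℝ} (hD : 0 ≤ D)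
    (hψ : ∀ z, |ψ z| ≤ D * ‖z‖) (s : Finset ℕ) :
    ∑ k ∈ s, |ψ (lp.single t k (1 : ℝ))| ^ t' ≤ D ^ t' := by
  have ht0 := toReal_pos_of_one_le ht
  set c : ℕ → ℝ := fun k => ψ (lp.single t k (1 : ℝ)) with hc
  set S := ∑ k ∈ s, |c k| ^ t' with hS
  have hS0 : 0 ≤ S := by positivity
  let v : ℕ → ℝ := fun k => SignType.sign (c k) * |c k| ^ (t' - 1)
  have hv : ∀ k, c k * v k = |c k| ^ t' := fun k => by
    calc c k * v k = |c k| * |c k| ^ (t' - 1) := by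
          simp only [v]; rw [← mul_assoc, mul_comm (c k), sign_mul_self]
      _ = |c k| ^ t' := by
          rcases (abs_nonneg (c k)).eq_or_lt with h0 | h0
          · rw [← h0, zero_mul, Real.zero_rpow h.ne_zero]
          · rw [Real.rpow_sub_one h0.ne', mul_div_cancel₀ _ h0.ne']
  have hvn : ∀ k, ‖v k‖ ^ t.toReal ≤ |c k| ^ t' := fun k => by
    have h1 : ‖v k‖ ≤ |c k| ^ (t' - 1) := by
      simp only [v, norm_mul, Real.norm_eq_abs]
      rw [abs_of_nonneg (by positivity : 0 ≤ |c k| ^ (t' - 1))]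
      refine mul_le_of_le_one_left (by positivity) ?_
      rcases lt_trichotomy (c k) 0 with h0 | h0 | h0 <;> simp [h0]
    refine (Real.rpow_le_rpow (norm_nonneg _) h1 ht0.le).trans_eq ?_
    rw [← Real.rpow_mul (abs_nonneg _), h.sub_one_mul_conj]
  let z : Ell t := ∑ k ∈ s, lp.single t k (v k)
  have hz : ‖z‖ ^ t.toReal ≤ S := by
    rw [lp.norm_sum_single ht0]
    exact Finset.sum_le_sum fun k _ => hvn k
  have hzψ : ψ z = S := by
    simp only [z, map_sum, hS]
    refine Finset.sum_congr rfl fun k _ => ?_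
    rw [← hv k, mul_comm, hc]
    have : lp.single (E := fun _ : ℕ => ℝ) t k (v k) = v k • lp.single t k (1 : ℝ) := by
      rw [← lp.single_smul, smul_eq_mul, mul_one]
    rw [this, map_smul, smul_eq_mul]
  have hzn : ‖z‖ ≤ S ^ (1 / t.toReal) := by
    rw [← Real.rpow_le_rpow_iff (norm_nonneg _) (by positivity) ht0, ← Real.rpow_mul hS0,
      one_div_mul_cancel ht0.ne', Real.rpow_one]
    exact hz
  have h1 : S ≤ D * S ^ (1 / t.toReal) := by
    have h2 := hψ z
    rw [hzψ, abs_of_nonneg hS0] at h2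
    exact h2.trans (by gcongr)
  rcases hS0.eq_or_lt with h0 | h0
  · rw [← h0]; positivity
  · have h2 : S ^ (1 / t') * S ^ (1 / t.toReal) = S := by
      rw [← Real.rpow_add h0, h.one_div_add_one_div, one_div_one, Real.rpow_one]
    have h3 : S ^ (1 / t') ≤ D := by
      refine le_of_mul_le_mul_right (a := S ^ (1 / t.toReal)) ?_ (by positivity)
      rwa [h2]
    have h4 := Real.rpow_le_rpow (by positivity) h3 h.nonneg
    rwa [← Real.rpow_mul hS0, one_div_mul_cancel h.ne_zero, Real.rpow_one] at h4

theorem abs_sum_functional_le {t : ℝ≥0∞} [Fact (1 ≤ t)] (ht : t ≠ ∞) {κ : Type*} [Fintype κ]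
    (L : κ → Ell t →L[ℝ] ℝ) (y : κ → Ell t) {B : ℝ}
    (hB : ∀ s : Finset ℕ, ∑ k ∈ s, eucl (fun i => L i (lp.single t k (1 : ℝ))) *
      eucl (fun i => y i k) ≤ B) : |∑ i, L i (y i)| ≤ B := by
  have h1 : HasSum (fun k => ∑ i, L i (lp.single t k (1 : ℝ)) * y i k) (∑ i, L i (y i)) := by
    refine hasSum_sum fun i _ => ?_
    have h2 := (L i).hasSum (lp.hasSum_single ht (y i))
    convert h2 using 2 with k
    have : lp.single (E := fun _ : ℕ => ℝ) t k (y i k) = y i k • lp.single t k (1 : ℝ) := by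
      rw [← lp.single_smul, smul_eq_mul, mul_one]
    rw [this, map_smul, smul_eq_mul, mul_comm]
  refine le_of_tendsto (h1.abs) (Eventually.of_forall fun s => ?_)
  refine (Finset.abs_sum_le_sum_abs _ _).trans (le_trans (Finset.sum_le_sum fun k _ => ?_) (hB s))
  have hcs := Finset.sum_mul_sq_le_sq_mul_sq Finset.univ
    (fun i => L i (lp.single t k (1 : ℝ))) (fun i => y i k)
  rw [← eucl_sq, ← eucl_sq, ← mul_pow] at hcs
  exact abs_le_of_sq_le_sq hcs (mul_nonneg (eucl_nonneg _) (eucl_nonneg _))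

/-- The Hölder estimate behind the incomparability: `V` is bounded in `ℓ_2` and much better than
trivially in `ℓ_∞`, hence better than trivially in `ℓ_{r'}`, while `U` is bounded in `ℓ_r`. -/
theorem sum_mul_le_of_interpolation {r r' : ℝ} (h : r.HolderConjugate r') (hr' : 2 ≤ r')
    {U V : ℕ → ℝ} (hU0 : ∀ k, 0 ≤ U k) (hV0 : ∀ k, 0 ≤ V k) (s : Finset ℕ) {n : ℝ} (hn : 0 < n)
    {a b d : ℝ} (ha : 0 ≤ a) (hb : 0 ≤ b) (hU : ∑ k ∈ s, U k ^ r ≤ (a * √n) ^ r)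
    (hV : ∀ k, V k ≤ b * n ^ (1 / 2 - d)) (hV2 : ∑ k ∈ s, V k ^ 2 ≤ n * b ^ 2) :
    ∑ k ∈ s, U k * V k ≤ n * (a * b * n ^ (-(d * (1 - 2 / r')))) := by
  have hr0 := h.pos
  have hr0' := h.symm.pos
  have hsplit : ∀ x : ℝ, 0 ≤ x → x ^ r' = x ^ (r' - 2) * x ^ 2 := by
    intro x hx
    rw [← Real.rpow_natCast, ← Real.rpow_add_of_nonneg hx (sub_nonneg.2 hr') (by norm_num)]
    norm_num
  have h1 : (∑ k ∈ s, U k ^ r) ^ (1 / r) ≤ a * √n := by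
    have := Real.rpow_le_rpow (Finset.sum_nonneg fun k _ => Real.rpow_nonneg (hU0 k) r) hU
      h.one_div_nonneg
    rwa [← Real.rpow_mul (by positivity), mul_one_div_cancel hr0.ne', Real.rpow_one] at this
  have h2 : ∑ k ∈ s, V k ^ r' ≤ (b * n ^ (1 / 2 - d * (1 - 2 / r'))) ^ r' := by
    calc ∑ k ∈ s, V k ^ r' ≤ ∑ k ∈ s, (b * n ^ (1 / 2 - d)) ^ (r' - 2) * V k ^ 2 := by
          refine Finset.sum_le_sum fun k _ => ?_
          rw [hsplit _ (hV0 k)]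
          gcongr
          · exact hV0 k
          · exact hV k
      _ ≤ (b * n ^ (1 / 2 - d)) ^ (r' - 2) * (n * b ^ 2) := by
          rw [← Finset.mul_sum]
          gcongr
      _ = b ^ (r' - 2) * b ^ 2 * (n ^ ((1 / 2 - d) * (r' - 2)) * n) := by
          rw [Real.mul_rpow hb (by positivity), ← Real.rpow_mul hn.le]; ring
      _ = b ^ r' * n ^ ((1 / 2 - d) * (r' - 2) + 1) := by
          rw [← hsplit _ hb, Real.rpow_add_one hn.ne']
      _ = (b * n ^ (1 / 2 - d * (1 - 2 / r'))) ^ r' := by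
          rw [Real.mul_rpow hb (by positivity), ← Real.rpow_mul hn.le]
          congr 2
          field_simp
          ring
  have h3 : (∑ k ∈ s, V k ^ r') ^ (1 / r') ≤ b * n ^ (1 / 2 - d * (1 - 2 / r')) := by
    have := Real.rpow_le_rpow (Finset.sum_nonneg fun k _ => Real.rpow_nonneg (hV0 k) r') h2
      h.symm.one_div_nonneg
    rwa [← Real.rpow_mul (by positivity), mul_one_div_cancel hr0'.ne', Real.rpow_one] at this
  calc ∑ k ∈ s, U k * V k ≤ (∑ k ∈ s, U k ^ r) ^ (1 / r) * (∑ k ∈ s, V k ^ r') ^ (1 / r') :=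
        Real.inner_le_Lp_mul_Lq_of_nonneg _ h (fun k _ => hU0 k) fun k _ => hV0 k
    _ ≤ a * √n * (b * n ^ (1 / 2 - d * (1 - 2 / r'))) := by
        gcongr
        exact Real.rpow_nonneg (Finset.sum_nonneg fun k _ => Real.rpow_nonneg (hV0 k) r') _
    _ = n * (a * b * n ^ (-(d * (1 - 2 / r')))) := by
        have e1 : √n * n ^ (1 / 2 - d * (1 - 2 / r')) = n * n ^ (-(d * (1 - 2 / r'))) := by
          rw [Real.sqrt_eq_rpow, ← Real.rpow_add hn]
          nth_rewrite 2 [← Real.rpow_one n]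
          rw [← Real.rpow_add hn]
          congr 1
          ring
        calc _ = a * b * (√n * n ^ (1 / 2 - d * (1 - 2 / r'))) := by ring
          _ = _ := by rw [e1]; ring

/-! ### Averaged trace pairings -/

section Pairing

variable {X Y W Z : Type*}
  [NormedAddCommGroup X] [NormedSpace ℝ X] [NormedAddCommGroup Y] [NormedSpace ℝ Y]
  [NormedAddCommGroup W] [NormedSpace ℝ W] [NormedAddCommGroup Z] [NormedSpace ℝ Z]

/-- The functional `R ↦ (1 / |κ|) ∑ i, L i (R (x i))` on `L(X,Y)`. -/
noncomputable def meanPairing {κ : Type*} [Fintype κ] (L : κ → Y →L[ℝ] ℝ) (x : κ → X) :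
    (X →L[ℝ] Y) →ₗ[ℝ] ℝ where
  toFun R := (Fintype.card κ : ℝ)⁻¹ * ∑ i, L i (R (x i))
  map_add' R R' := by
    simp [Finset.sum_add_distrib, mul_add]
  map_smul' c R := by
    simp only [_root_.smul_apply, map_smul, smul_eq_mul, ← Finset.mul_sum,
      RingHom.id_apply]
    ring

theorem meanPairing_apply {κ : Type*} [Fintype κ] (L : κ → Y →L[ℝ] ℝ) (x : κ → X)
    (R : X →L[ℝ] Y) : meanPairing L x R = (Fintype.card κ : ℝ)⁻¹ * ∑ i, L i (R (x i)) := rfl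

theorem abs_meanPairing_le {κ : Type*} [Fintype κ] {L : κ → Y →L[ℝ] ℝ} {x : κ → X}
    (hL : ∀ i y, |L i y| ≤ ‖y‖) (hx : ∀ i, ‖x i‖ ≤ 1) (R : X →L[ℝ] Y) :
    |meanPairing L x R| ≤ 1 * ‖R‖ := by
  rw [meanPairing_apply, abs_mul, abs_of_nonneg (by positivity), one_mul]
  have h1 : |∑ i, L i (R (x i))| ≤ Fintype.card κ * ‖R‖ := by
    refine (Finset.abs_sum_le_sum_abs _ _).trans ?_
    calc ∑ i, |L i (R (x i))| ≤ ∑ _i : κ, ‖R‖ := by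
          refine Finset.sum_le_sum fun i _ => (hL i _).trans ((R.le_opNorm _).trans ?_)
          exact mul_le_of_le_one_right (norm_nonneg _) (hx i)
      _ = Fintype.card κ * ‖R‖ := by simp
  rcases (Nat.cast_nonneg (α := ℝ) (Fintype.card κ)).eq_or_lt with h0 | h0
  · rw [← h0]; simp
  · exact (inv_mul_le_iff₀ h0).2 h1

theorem notMem_factorIdeal_of_pairing {S : W →L[ℝ] Z} {T : X →L[ℝ] Y} {κ : ℕ → Type}
    [∀ n, Fintype (κ n)] [∀ n, Nonempty (κ n)] {L : ∀ n, κ n → Y →L[ℝ] ℝ} {x : ∀ n, κ n → X}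
    (hL : ∀ n i y, |L n i y| ≤ ‖y‖) (hx : ∀ n i, ‖x n i‖ ≤ 1)
    (h : ∀ A B, Tendsto (fun n => meanPairing (L n) (x n) (A ∘L S ∘L B)) atTop (𝓝 0))
    (hT : ∀ n i, L n i (T (x n i)) = 1) : T ∉ factorIdeal X Y S := by
  intro hmem
  have h1 := tendsto_zero_of_mem_factorIdeal (fun n => meanPairing (L n) (x n)) 1
    (fun n R => abs_meanPairing_le (hL n) (hx n) R) h hmem
  have h2 : (fun n => meanPairing (L n) (x n) T) = fun _ => 1 := by
    ext n
    simp [meanPairing_apply, hT]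
  rw [h2] at h1
  exact one_ne_zero (tendsto_nhds_unique tendsto_const_nhds h1)

end Pairing

/-! ### Incomparability of the two ideals -/

section Incomparable

theorem one_lt_toReal {p : ℝ≥0∞} (hp : 1 < p) (hp' : p ≠ ∞) : 1 < p.toReal := by
  simpa using (ENNReal.toReal_lt_toReal ENNReal.one_ne_top hp').2 hp

theorem two_le_toReal {q : ℝ≥0∞} (hq : 2 ≤ q) (hq' : q ≠ ∞) : 2 ≤ q.toReal := by
  simpa using (ENNReal.toReal_le_toReal (by simp) hq').2 hq

theorem toReal_le_two {p : ℝ≥0∞} (hp : p ≤ 2) : p.toReal ≤ 2 := by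
  simpa using (ENNReal.toReal_le_toReal (ne_top_of_le_ne_top (by simp) hp) (by simp)).2 hp

theorem holderConjugate_le_two {r r' : ℝ} (h : r.HolderConjugate r') (hr : 2 ≤ r') : r ≤ 2 := by
  have h1 := h.mul_eq_add
  nlinarith [h.pos]

theorem two_le_of_holderConjugate {r r' : ℝ} (h : r.HolderConjugate r') (hr : r ≤ 2) : 2 ≤ r' := by
  have h1 := h.mul_eq_add
  nlinarith [h.lt]

/-- The `n`-th block of coordinates in `ℓ_2`. -/
abbrev CoordBlock (n : ℕ) : Type := Fin (n + 1)

/-- The `n`-th block of signs, indexing the coordinates of a copy of `ℓ_r^N`, `N = 2 ^ (n + 1)`,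
in which the Rademacher functions span a copy of `ℓ_2^{n + 1}`. -/
abbrev SignBlock (n : ℕ) : Type := CoordBlock n → Bool

/-- For `q ≥ 2` there is an operator `ℓ_2 → ℓ_q` that maps the unit vectors of each block to the
normalized Rademacher functions. -/
theorem exists_rademacher_embedding {q : ℝ≥0∞} [Fact (1 ≤ q)] (h2q : 2 ≤ q) (hq : q ≠ ∞) :
    ∃ A : Ell 2 →L[ℝ] Ell q, ∀ x n w, A x (idx SignBlock ⟨n, w⟩) =
      ∑ i, x (idx CoordBlock ⟨n, i⟩) * radCol q.toReal i w := by
  have hQ := toReal_pos_of_one_le hq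
  obtain ⟨A, hA⟩ := exists_block_operator (J := CoordBlock) (I := SignBlock) h2q hq
    (fun n w i => radCol q.toReal i w) (C := khC q.toReal ^ (1 / q.toReal))
    (by have := khC_pos hQ; positivity) (fun n u => by
      simp only [mul_comm _ (u _)]
      simpa only [ENNReal.toReal_ofNat, lpn_two] using lpn_radCol_le hQ u)
  exact ⟨A, fun x n w => by simp only [hA, mul_comm]⟩

/-- For `1 < p ≤ 2` there is an operator `ℓ_p → ℓ_2` that maps the normalized Rademacher functions
of each block to the unit vectors. -/
theorem exists_rademacher_quotient {p : ℝ≥0∞} [Fact (1 ≤ p)] (hp2 : p ≤ 2) {p' : ℝ}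
    (hpp : p.toReal.HolderConjugate p') :
    ∃ B : Ell p →L[ℝ] Ell 2, ∀ x n i, B x (idx CoordBlock ⟨n, i⟩) =
      ∑ w, radCol p' i w * x (idx SignBlock ⟨n, w⟩) := by
  have hK := khC_pos hpp.symm.pos
  exact exists_block_operator (J := SignBlock) (I := CoordBlock) hp2 (by simp)
    (fun n i w => radCol p' i w) (C := khC p' ^ (1 / p')) (by positivity) (fun n u => by
      simpa only [ENNReal.toReal_ofNat, lpn_two] using eucl_radCol_le hpp u)

theorem tendsto_const_mul_rpow_neg (c : ℝ) {d : ℝ} (hd : 0 < d) :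
    Tendsto (fun n : ℕ => c * ((n : ℝ) + 1) ^ (-d)) atTop (𝓝 0) := by
  have h := (tendsto_rpow_neg_atTop hd).comp
    (tendsto_atTop_add_const_right _ (1 : ℝ) tendsto_natCast_atTop_atTop)
  simpa using h.const_mul c

theorem const_mul_rpow {C x r : ℝ} (hr : 0 < r) (hC : 0 ≤ C) (hx : 0 ≤ x) :
    C * x ^ r = (C ^ (1 / r) * x) ^ r := by
  rw [Real.mul_rpow (by positivity) hx, ← Real.rpow_mul hC, one_div_mul_cancel hr.ne',
    Real.rpow_one]

theorem abs_apply_le_norm {t : ℝ≥0∞} [Fact (1 ≤ t)] (y : Ell t) (k : ℕ) : |y k| ≤ ‖y‖ :=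
  lp.norm_apply_le_norm (zero_lt_one.trans_le (Fact.out : 1 ≤ t)).ne' y k

theorem norm_single_one {t : ℝ≥0∞} [Fact (1 ≤ t)] (k : ℕ) :
    ‖(lp.single t k (1 : ℝ) : Ell t)‖ = 1 := by
  rw [lp.norm_single (zero_lt_one.trans_le (Fact.out : 1 ≤ t)), norm_one]

theorem norm_blockVec_ite {t : ℝ≥0∞} [Fact (1 ≤ t)] (ht : t ≠ ∞) {J : ℕ → Type}
    [∀ n, Fintype (J n)] [∀ n, DecidableEq (J n)] (n : ℕ) (i : J n) :
    ‖blockVec t n (fun j => if j = i then (1 : ℝ) else 0)‖ = 1 := by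
  have ht0 := toReal_pos_of_one_le ht
  rw [norm_blockVec ht, lpn]
  have : ∀ j, |if j = i then (1 : ℝ) else 0| ^ t.toReal = if j = i then (1 : ℝ) else 0 := by
    intro j
    split_ifs <;> simp [ht0.ne']
  simp [this]

theorem radBlockFun_le {q : ℝ≥0∞} [Fact (1 ≤ q)] (hq : q ≠ ∞) {q' : ℝ} (h2 : q' ≤ 2)
    (hqq : q'.HolderConjugate q.toReal) (n : ℕ) (i : CoordBlock n) (y : Ell q) :
    |blockFun (I := SignBlock) q n (radCol q' i) y| ≤ ‖y‖ :=
  (abs_blockFun_le hq hqq n _ y).trans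
    (mul_le_of_le_one_left (norm_nonneg _) (lpn_radCol_self_le hqq.pos h2 i))

/-- If `B : ℓ_p → ℓ_t` and `p ≤ 2`, then in each coordinate
the images of the unit vectors of a block are small in the Euclidean sense. -/
theorem eucl_coord_le {p t : ℝ≥0∞} [Fact (1 ≤ p)] [Fact (1 ≤ t)] (hp2 : p ≤ 2)
    (B : Ell p →L[ℝ] Ell t) {J : ℕ → Type} [∀ n, Fintype (J n)] [∀ n, DecidableEq (J n)]
    (n k : ℕ) : eucl (fun i : J n => B (blockVec p n fun j => if j = i then 1 else 0) k) ≤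
      ‖B‖ * (Fintype.card (J n) : ℝ) ^ (1 / p.toReal - 1 / 2) := by
  have hp : p ≠ ∞ := ne_top_of_le_ne_top (by simp) hp2
  set a : J n → ℝ := fun i => B (blockVec p n fun j => if j = i then 1 else 0) k with ha
  have h1 : B (blockVec p n a) k = eucl a ^ 2 := by
    have e : a = fun j => ∑ i, a i * (if j = i then 1 else 0) := by ext j; simp
    have : B (blockVec p n a) = ∑ i, a i • B (blockVec p n fun j => if j = i then 1 else 0) := by
      conv_lhs => rw [e]
      rw [blockVec_sum, map_sum]
      simp only [map_smul]
    rw [this, ell_sum_apply, eucl_sq]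
    exact Finset.sum_congr rfl fun i _ => by rw [sq]
  have h2 : eucl a * eucl a ≤
      ‖B‖ * (Fintype.card (J n) : ℝ) ^ (1 / p.toReal - 1 / 2) * eucl a := by
    calc eucl a * eucl a = B (blockVec p n a) k := by rw [h1, sq]
      _ ≤ ‖B (blockVec p n a)‖ := (le_abs_self _).trans (abs_apply_le_norm _ k)
      _ ≤ ‖B‖ * lpn p.toReal a := by rw [← norm_blockVec hp]; exact B.le_opNorm _
      _ ≤ ‖B‖ * ((Fintype.card (J n) : ℝ) ^ (1 / p.toReal - 1 / 2) * eucl a) := by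
          gcongr
          rw [← lpn_two]
          exact lpn_le_card_rpow_mul (toReal_pos_of_one_le hp) (toReal_le_two hp2) a
      _ = _ := by ring
  rcases (eucl_nonneg a).eq_or_lt with h0 | h0
  · rw [← h0]; positivity
  · exact le_of_mul_le_mul_right h2 h0

/-- The operator `A ∘ I(p,2)`, where `A` embeds `ℓ_2^n`'s into `ℓ_q` by Rademacher functions, is
separated from `J^{I(2,q)}` by averaging over the unit vectors of `ℓ_p^n`. -/
theorem exists_notMem_factorIdeal_two_q {p q : ℝ≥0∞} [Fact (1 ≤ p)] [Fact (1 ≤ q)] (hp1 : 1 < p)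
    (hp2 : p ≤ 2) (h2q : 2 < q) (hq : q ≠ ∞) : ∃ A : Ell 2 →L[ℝ] Ell q,
      A ∘L formalInclusion p 2 hp2 ∉
        factorIdeal (Ell p) (Ell q) (formalInclusion 2 q h2q.le) := by
  have hp : p ≠ ∞ := ne_top_of_le_ne_top (by simp) hp2
  have hP := one_lt_toReal hp1 hp
  have hQ2 : 2 < q.toReal := by simpa using (ENNReal.toReal_lt_toReal (by simp) hq).2 h2q
  have hqq := (Real.HolderConjugate.conjExponent (one_lt_toReal (by
    exact lt_trans (by norm_num) h2q) hq)).symm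
  set q' := Real.conjExponent q.toReal
  have hq2 : q' ≤ 2 := holderConjugate_le_two hqq hQ2.le
  obtain ⟨A, hA⟩ := exists_rademacher_embedding h2q.le hq
  refine ⟨A, ?_⟩
  let L : ∀ n, CoordBlock n → Ell q →L[ℝ] ℝ := fun n i =>
    blockFun (I := SignBlock) q n (radCol q' i)
  let x : ∀ n, CoordBlock n → Ell p := fun n i => blockVec p n fun j => if j = i then 1 else 0
  have hL : ∀ n i y, |L n i y| ≤ ‖y‖ := fun n i y => radBlockFun_le hq hq2 hqq n i y
  have hx : ∀ n i, ‖x n i‖ = 1 := fun n i => norm_blockVec_ite hp n i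
  refine notMem_factorIdeal_of_pairing hL (fun n i => (hx n i).le) (fun A' B' => ?_)
    (fun n i => ?_)
  · obtain ⟨C, hC0, hC⟩ := exists_eucl_rpow_le_avg hqq.lt
    refine squeeze_zero_norm (fun n => ?_)
      (tendsto_const_mul_rpow_neg (C ^ (1 / q') * ‖A'‖ * ‖B'‖)
        (d := (1 - 1 / p.toReal) * (1 - 2 / q.toReal)) ?_)
    · have hn : (0 : ℝ) < (n : ℝ) + 1 := by positivity
      rw [meanPairing_apply, Fintype.card_fin, Nat.cast_add_one, Real.norm_eq_abs, abs_mul,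
        abs_of_pos (by positivity), inv_mul_le_iff₀ hn]
      refine abs_sum_functional_le hq (fun i => L n i ∘L A')
        (fun i => formalInclusion 2 q h2q.le (B' (x n i))) fun s => ?_
      refine sum_mul_le_of_interpolation hqq hQ2.le (fun _ => eucl_nonneg _)
        (fun _ => eucl_nonneg _) s hn (by positivity) (norm_nonneg _) ?_ (fun k => ?_) ?_
      · -- lower Khintchine: the square function is controlled by the functionals `∑ ± L n i`
        calc ∑ k ∈ s, eucl (fun i => (L n i ∘L A') (lp.single q k (1 : ℝ))) ^ q'
            ≤ ∑ k ∈ s, C * avg (fun w =>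
                |rad (fun i => (L n i ∘L A') (lp.single q k (1 : ℝ))) w| ^ q') :=
              Finset.sum_le_sum fun k _ => hC _ _
          _ = C * avg (fun w => ∑ k ∈ s,
                |rad (fun i => (L n i ∘L A') (lp.single q k (1 : ℝ))) w| ^ q') := by
              rw [← Finset.mul_sum, avg_sum]
          _ ≤ C * avg (fun _ : CoordBlock n → Bool => (‖A'‖ * √((n : ℝ) + 1)) ^ q') := by
              gcongr
              refine avg_mono fun w => ?_
              let ψ : Ell q →L[ℝ] ℝ :=
                blockFun (I := SignBlock) q n (fun v => ∑ i, sgn (w i) * radCol q' i v) ∘L A'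
              have hψ : ∀ k, rad (fun i => (L n i ∘L A') (lp.single q k (1 : ℝ))) w =
                  ψ (lp.single q k (1 : ℝ)) := fun k => by
                simp only [ψ, L, rad, ContinuousLinearMap.comp_apply, blockFun_sum, mul_comm]
              simp only [hψ]
              refine sum_functional_rpow_le hq hqq ψ (by positivity) (fun z => ?_) s
              calc |ψ z| ≤ lpn q' (fun v => ∑ i, sgn (w i) * radCol q' i v) * ‖A' z‖ :=
                    abs_blockFun_le hq hqq n _ _
                _ ≤ √((n : ℝ) + 1) * (‖A'‖ * ‖z‖) := by
                    gcongr
                    · refine (lpn_radCol_le_of_le_two hqq.pos hq2 _).trans_eq ?_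
                      rw [eucl_sgn, Fintype.card_fin, Nat.cast_add_one]
                    · exact A'.le_opNorm z
                _ = ‖A'‖ * √((n : ℝ) + 1) * ‖z‖ := by ring
          _ = (C ^ (1 / q') * ‖A'‖ * √((n : ℝ) + 1)) ^ q' := by
              rw [avg_const, mul_assoc, const_mul_rpow hqq.pos hC0.le (by positivity)]
      · have := eucl_coord_le (J := CoordBlock) hp2 B' n k
        simp only [formalInclusion_apply]
        refine this.trans_eq ?_
        rw [Fintype.card_fin, Nat.cast_add_one]
        congr 2
        ring
      · simp only [formalInclusion_apply, eucl_sq]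
        rw [Finset.sum_comm]
        calc ∑ i, ∑ k ∈ s, B' (x n i) k ^ 2 ≤ ∑ _i : CoordBlock n, ‖B'‖ ^ 2 := by
              refine Finset.sum_le_sum fun i _ => (sum_sq_le_norm_sq _ s).trans ?_
              gcongr
              simpa [hx] using B'.le_opNorm (x n i)
          _ = ((n : ℝ) + 1) * ‖B'‖ ^ 2 := by simp
    · have h1 : 1 / p.toReal < 1 := by rw [div_lt_one (by linarith)]; exact hP
      have h2 : 2 / q.toReal < 1 := by rw [div_lt_one (by linarith)]; exact hQ2
      exact mul_pos (by linarith) (by linarith)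
  · simp only [L, blockFun_apply, ContinuousLinearMap.comp_apply, hA, formalInclusion_apply, x,
      blockVec_apply, sum_ite_mul_radCol]
    rw [sum_radCol_mul_radCol hqq, if_pos rfl]

/-- The operator `I(2,q) ∘ B`, where `B` projects `ℓ_p` onto `ℓ_2^n`'s spanned by Rademacher
functions, is separated from `J^{I(p,2)}` by averaging over those functions. -/
theorem exists_notMem_factorIdeal_p_two {p q : ℝ≥0∞} [Fact (1 ≤ p)] [Fact (1 ≤ q)] (hp1 : 1 < p)
    (hp2 : p < 2) (h2q : 2 ≤ q) (hq : q ≠ ∞) : ∃ B : Ell p →L[ℝ] Ell 2,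
      formalInclusion 2 q h2q ∘L B ∉
        factorIdeal (Ell p) (Ell q) (formalInclusion p 2 hp2.le) := by
  have hp : p ≠ ∞ := hp2.ne_top
  have hP := one_lt_toReal hp1 hp
  have hP2 : p.toReal < 2 := by simpa using (ENNReal.toReal_lt_toReal hp (by simp)).2 hp2
  have hQ2 := two_le_toReal h2q hq
  have hpp := Real.HolderConjugate.conjExponent hP
  set p' := Real.conjExponent p.toReal
  have hp2' : 2 ≤ p' := two_le_of_holderConjugate hpp hP2.le
  obtain ⟨B, hB⟩ := exists_rademacher_quotient hp2.le hpp
  refine ⟨B, ?_⟩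
  let L : ∀ n, CoordBlock n → Ell q →L[ℝ] ℝ := fun n i =>
    lp.evalCLM ℝ (fun _ : ℕ => ℝ) q (idx CoordBlock ⟨n, i⟩)
  have hLa : ∀ n i y, L n i y = y (idx CoordBlock ⟨n, i⟩) := fun n i y => rfl
  let x : ∀ n, CoordBlock n → Ell p := fun n i => blockVec (J := SignBlock) p n (radCol p.toReal i)
  have hL : ∀ n i y, |L n i y| ≤ ‖y‖ := fun n i y => abs_apply_le_norm y _
  have hx : ∀ n i, ‖x n i‖ ≤ 1 := fun n i => by
    rw [norm_blockVec hp]; exact lpn_radCol_self_le hpp.pos hP2.le i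
  refine notMem_factorIdeal_of_pairing hL hx (fun A' B' => ?_) (fun n i => ?_)
  · obtain ⟨C, hC0, hC⟩ := exists_eucl_rpow_le_avg hP
    refine squeeze_zero_norm (fun n => ?_)
      (tendsto_const_mul_rpow_neg (C ^ (1 / p.toReal) * ‖B'‖ * ‖A'‖)
        (d := 1 / q.toReal * (1 - 2 / p')) ?_)
    · have hn : (0 : ℝ) < (n : ℝ) + 1 := by positivity
      rw [meanPairing_apply, Fintype.card_fin, Nat.cast_add_one, Real.norm_eq_abs, abs_mul,
        abs_of_pos (by positivity), inv_mul_le_iff₀ hn]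
      refine abs_sum_functional_le (by simp) (fun i => L n i ∘L A')
        (fun i => formalInclusion p 2 hp2.le (B' (x n i))) fun s => ?_
      refine (Finset.sum_congr rfl fun k _ => mul_comm _ _).trans_le ?_
      refine sum_mul_le_of_interpolation hpp hp2' (fun _ => eucl_nonneg _)
        (fun _ => eucl_nonneg _) s hn (by positivity) (norm_nonneg _) ?_ (fun k => ?_) ?_
      · -- lower Khintchine: the square function is controlled by the vectors `∑ ± B' (x n i)`
        simp only [formalInclusion_apply]
        calc ∑ k ∈ s, eucl (fun i => B' (x n i) k) ^ p.toReal
            ≤ ∑ k ∈ s, C * avg (fun w => |rad (fun i => B' (x n i) k) w| ^ p.toReal) :=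
              Finset.sum_le_sum fun k _ => hC _ _
          _ = C * avg (fun w => ∑ k ∈ s, |rad (fun i => B' (x n i) k) w| ^ p.toReal) := by
              rw [← Finset.mul_sum, avg_sum]
          _ ≤ C * avg (fun _ : CoordBlock n → Bool => (‖B'‖ * √((n : ℝ) + 1)) ^ p.toReal) := by
              gcongr
              refine avg_mono fun w => ?_
              let z : Ell p := blockVec (J := SignBlock) p n
                fun v => ∑ i, sgn (w i) * radCol p.toReal i v
              have hz : ∀ k, rad (fun i => B' (x n i) k) w = B' z k := fun k => by
                simp only [z, x, blockVec_sum, map_sum, map_smul]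
                rw [ell_sum_apply]
                simp only [rad, mul_comm]
              simp only [hz]
              refine (lp.sum_rpow_le_norm_rpow hpp.pos (B' z) s).trans ?_
              refine Real.rpow_le_rpow (norm_nonneg _) ((B'.le_opNorm z).trans ?_) hpp.nonneg
              gcongr
              rw [norm_blockVec hp]
              refine (lpn_radCol_le_of_le_two hpp.pos hP2.le _).trans_eq ?_
              rw [eucl_sgn, Fintype.card_fin, Nat.cast_add_one]
          _ = (C ^ (1 / p.toReal) * ‖B'‖ * √((n : ℝ) + 1)) ^ p.toReal := by
              rw [avg_const, mul_assoc, const_mul_rpow hpp.pos hC0.le (by positivity)]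
      · simp only [ContinuousLinearMap.comp_apply, hLa]
        set y := A' (lp.single 2 k (1 : ℝ)) with hy
        have hyn : ‖y‖ ≤ ‖A'‖ := by
          have := A'.le_opNorm (lp.single 2 k (1 : ℝ))
          rwa [norm_single_one, mul_one] at this
        calc eucl (fun i : CoordBlock n => y (idx CoordBlock ⟨n, i⟩))
            ≤ (Fintype.card (CoordBlock n) : ℝ) ^ (1 / 2 - 1 / q.toReal) *
                lpn q.toReal (fun i : CoordBlock n => y (idx CoordBlock ⟨n, i⟩)) := by
              rw [← lpn_two]
              exact lpn_le_card_rpow_mul two_pos hQ2 _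
          _ ≤ ((n : ℝ) + 1) ^ (1 / 2 - 1 / q.toReal) * ‖A'‖ := by
              rw [Fintype.card_fin, Nat.cast_add_one]
              gcongr
              exact (lpn_block_le hq y n).trans hyn
          _ = ‖A'‖ * ((n : ℝ) + 1) ^ (1 / 2 - 1 / q.toReal) := mul_comm _ _
      · simp only [eucl_sq]
        rw [Finset.sum_comm]
        calc ∑ i, ∑ k ∈ s, (L n i ∘L A') (lp.single 2 k (1 : ℝ)) ^ 2
            ≤ ∑ _i : CoordBlock n, ‖A'‖ ^ 2 := by
              refine Finset.sum_le_sum fun i _ => ?_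
              have := sum_functional_rpow_le (t := 2) (by simp) (t' := 2)
                (by simpa using Real.HolderConjugate.two_two) (L n i ∘L A') (norm_nonneg A')
                (fun z => (hL n i _).trans (A'.le_opNorm z)) s
              simpa only [Real.rpow_ofNat, sq_abs] using this
          _ = ((n : ℝ) + 1) * ‖A'‖ ^ 2 := by simp
    · have hp2'' : 2 < p' := by
        refine lt_of_le_of_ne hp2' fun h => ?_
        have h1 := hpp.mul_eq_add
        rw [← h] at h1
        linarith
      have h2 : 2 / p' < 1 := by rw [div_lt_one (by linarith)]; exact hp2''
      exact mul_pos (by positivity) (by linarith)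
  · simp only [hLa, ContinuousLinearMap.comp_apply, formalInclusion_apply, hB, x, blockVec_apply]
    rw [sum_radCol_mul_radCol hpp.symm, if_pos rfl]

end Incomparable

/-! ### An operator factoring through `ℓ_2` which is not finitely strictly singular -/

theorem exists_mem_factorIdeal_id_not_fss {p q : ℝ≥0∞} [Fact (1 ≤ p)] [Fact (1 ≤ q)]
    (hp1 : 1 < p) (hp2 : p ≤ 2) (h2q : 2 ≤ q) (hq : q ≠ ∞) : ∃ T : Ell p →L[ℝ] Ell q,
      T ∈ factorIdeal (Ell p) (Ell q) (ContinuousLinearMap.id ℝ (Ell 2)) ∧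
        ¬ FinitelyStrictlySingular T := by
  have hp : p ≠ ∞ := ne_top_of_le_ne_top (by simp) hp2
  have hP2 := toReal_le_two hp2
  have hQ2 := two_le_toReal h2q hq
  have hpp := Real.HolderConjugate.conjExponent (one_lt_toReal hp1 hp)
  obtain ⟨A, hA⟩ := exists_rademacher_embedding h2q hq
  obtain ⟨B, hB⟩ := exists_rademacher_quotient hp2 hpp
  refine ⟨A ∘L ContinuousLinearMap.id ℝ (Ell 2) ∘L B, mem_factorIdeal _ A B, fun h => ?_⟩
  rw [ContinuousLinearMap.id_comp] at h
  obtain ⟨n, -, hn⟩ := finitelyStrictlySingular_iff.1 h (1 / 2) (by norm_num)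
  let Λ : (CoordBlock n → ℝ) →ₗ[ℝ] Ell p := Fintype.linearCombination ℝ fun i =>
    blockVec (J := SignBlock) p n (radCol p.toReal i)
  have hΛ : ∀ u, Λ u = blockVec (J := SignBlock) p n
      fun w => ∑ i, u i * radCol p.toReal i w := fun u => by
    rw [blockVec_sum]; rfl
  have hup : ∀ u, ‖Λ u‖ ≤ eucl u := fun u => by
    rw [hΛ, norm_blockVec hp]
    exact lpn_radCol_le_of_le_two hpp.pos hP2 u
  have hlow : ∀ u, eucl u ≤ ‖A (B (Λ u))‖ := fun u => by
    have h1 : ∀ i, B (Λ u) (idx CoordBlock ⟨n, i⟩) = u i := fun i => by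
      rw [hB, hΛ]
      simp only [blockVec_apply, Finset.mul_sum]
      rw [Finset.sum_comm]
      simp only [mul_left_comm _ (u _), ← Finset.mul_sum, sum_radCol_mul_radCol hpp.symm]
      simp
    have h2 := lpn_block_le (J := SignBlock) hq (A (B (Λ u))) n
    simp only [hA, h1] at h2
    exact (eucl_le_lpn_radCol hQ2 u).trans h2
  have hinj : Function.Injective Λ := by
    rw [← LinearMap.ker_eq_bot, LinearMap.ker_eq_bot']
    intro u hu
    refine eucl_eq_zero (le_antisymm ?_ (eucl_nonneg u))
    have := hlow u
    rwa [hu, map_zero, map_zero, norm_zero] at this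
  obtain ⟨_, ⟨u, rfl⟩, hu0, hu⟩ := hn (LinearMap.range Λ) (by
    rw [LinearMap.finrank_range_of_inj hinj]
    simp)
  have h1 : 0 < ‖Λ u‖ := norm_pos_iff.2 hu0
  have h2 := hup u
  have h3 := hlow u
  rw [ContinuousLinearMap.comp_apply] at hu
  linarith

/-! ### Incoherent orthonormal bases -/

section Tensor

/-- The `k`-th tensor power of a `2 × 2` matrix. -/
def tens (M : Bool → Bool → ℝ) (k : ℕ) (x y : Fin k → Bool) : ℝ := ∏ i, M (x i) (y i)

theorem sum_tens_mul_tens (M M' : Bool → Bool → ℝ) (k : ℕ) (y z : Fin k → Bool) :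
    ∑ x, tens M k x y * tens M' k x z = ∏ i, ∑ a, M a (y i) * M' a (z i) := by
  rw [Finset.prod_univ_sum, Fintype.piFinset_univ]
  exact Finset.sum_congr rfl fun x _ => Finset.prod_mul_distrib.symm

theorem sum_tens_mul_tens_eq {M : Bool → Bool → ℝ} {c : ℝ}
    (hM : ∀ b b', ∑ a, M a b * M a b' = if b = b' then c else 0) (k : ℕ) (y z : Fin k → Bool) :
    ∑ x, tens M k x y * tens M k x z = if y = z then c ^ k else 0 := by
  rw [sum_tens_mul_tens]
  simp only [hM]
  split_ifs with h
  · subst h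
    simp
  · obtain ⟨i, hi⟩ := Function.ne_iff.1 h
    exact Finset.prod_eq_zero (Finset.mem_univ i) (by rw [if_neg hi])

/-- The `2 × 2` Hadamard matrix. -/
def had (a b : Bool) : ℝ := if a && b then -1 else 1

theorem sum_had (b b' : Bool) : ∑ a, had a b * had a b' = if b = b' then 2 else 0 := by
  cases b <;> cases b' <;> (simp [had]; try norm_num)

theorem abs_tens_had (k : ℕ) (x y : Fin k → Bool) : |tens had k x y| = 1 := by
  rw [tens, Finset.abs_prod]
  refine Finset.prod_eq_one fun i _ => ?_
  cases x i <;> cases y i <;> simp [had]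

/-- The rotation of the plane by the angle `θ`. -/
noncomputable def rot (θ : ℝ) (a b : Bool) : ℝ :=
  if a = b then Real.cos θ else if a then Real.sin θ else -Real.sin θ

theorem sum_rot_mul_rot (θ φ : ℝ) (b b' : Bool) :
    ∑ a, rot θ a b * rot φ a b' = rot (φ - θ) b b' := by
  cases b <;> cases b' <;> simp [rot, Real.cos_sub, Real.sin_sub] <;> ring

theorem sum_rot_self (θ : ℝ) (b b' : Bool) :
    ∑ a, rot θ a b * rot θ a b' = if b = b' then 1 else 0 := by
  rw [sum_rot_mul_rot, sub_self, rot]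
  cases b <;> cases b' <;> simp

theorem exists_abs_rot_le {x : ℝ} (hx : x ≠ 0) (hx1 : |x| < 1) :
    ∃ c, 0 ≤ c ∧ c < 1 ∧ ∀ a b, |rot x a b| ≤ c := by
  have hpi := Real.pi_gt_three
  have hcos : 0 < Real.cos x := by
    rw [← Real.cos_abs]
    exact Real.cos_pos_of_mem_Ioo ⟨by linarith [abs_nonneg x], by linarith⟩
  have hsin : Real.sin x ≠ 0 := by
    have h1 : 0 < Real.sin |x| := Real.sin_pos_of_pos_of_lt_pi (abs_pos.2 hx) (by linarith)
    intro h0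
    rcases abs_choice x with h | h <;> rw [h] at h1
    · linarith
    · rw [Real.sin_neg] at h1; linarith
  have h1 := Real.sin_sq_add_cos_sq x
  have hs : 0 < Real.sin x ^ 2 := by positivity
  have hc : 0 < Real.cos x ^ 2 := by positivity
  have hc1 : |Real.cos x| < 1 := by rw [← sq_lt_one_iff_abs_lt_one]; linarith
  have hs1 : |Real.sin x| < 1 := by rw [← sq_lt_one_iff_abs_lt_one]; linarith
  refine ⟨max |Real.cos x| |Real.sin x|, le_max_of_le_left (abs_nonneg _), max_lt hc1 hs1,
    fun a b => ?_⟩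
  cases a <;> cases b <;> simp [rot]

/-- Arbitrarily many orthonormal bases of some `ℝ^b` with arbitrarily small mutual coherence,
namely high tensor powers of rotations of the plane by distinct angles. -/
theorem exists_incoherent_bases (Λ : Type) [Fintype Λ] {μ : ℝ} (hμ : 0 < μ) :
    ∃ (k : ℕ) (O : Λ → (Fin k → Bool) → (Fin k → Bool) → ℝ),
      (∀ m y z, ∑ x, O m x y * O m x z = if y = z then 1 else 0) ∧
      ∀ m m', m ≠ m' → ∀ y z, |∑ x, O m x y * O m' x z| ≤ μ := by
  let e := Fintype.equivFin Λ
  let θ : Λ → ℝ := fun m => (e m : ℕ) / (Fintype.card Λ : ℝ)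
  have hθ : ∀ m m', m ≠ m' → θ m' - θ m ≠ 0 ∧ |θ m' - θ m| < 1 := by
    intro m m' hm
    have hc : (0 : ℝ) < Fintype.card Λ := by
      have := (e m).pos
      exact_mod_cast this
    have h0 : ∀ m, 0 ≤ θ m ∧ θ m < 1 := fun m => by
      refine ⟨by positivity, ?_⟩
      rw [div_lt_one hc]
      exact_mod_cast (e m).2
    refine ⟨fun h => hm ?_, ?_⟩
    · have h1 : (e m' : ℕ) / (Fintype.card Λ : ℝ) = (e m : ℕ) / (Fintype.card Λ : ℝ) := by
        simp only [θ] at h; linarith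
      rw [div_left_inj' hc.ne'] at h1
      have h2 : (e m' : ℕ) = e m := by exact_mod_cast h1
      exact (e.injective (Fin.ext h2)).symm
    · rw [abs_lt]
      constructor <;> linarith [(h0 m).1, (h0 m).2, (h0 m').1, (h0 m').2]
  have hev : ∀ᶠ k in atTop, ∀ m m', m ≠ m' → ∀ y z : Fin k → Bool,
      |∑ x, tens (rot (θ m)) k x y * tens (rot (θ m')) k x z| ≤ μ := by
    rw [eventually_all]
    intro m
    rw [eventually_all]
    intro m'
    by_cases hm : m = m'
    · simp [hm]
    obtain ⟨c, hc0, hc1, hc⟩ := exists_abs_rot_le (hθ m m' hm).1 (hθ m m' hm).2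
    filter_upwards [(tendsto_pow_atTop_nhds_zero_of_lt_one hc0 hc1).eventually_le_const hμ]
      with k hk _ y z
    rw [sum_tens_mul_tens, Finset.abs_prod]
    refine le_trans ?_ hk
    calc _ ≤ ∏ _i : Fin k, c := by
          refine Finset.prod_le_prod (fun i _ => abs_nonneg _) fun i _ => ?_
          rw [sum_rot_mul_rot]
          exact hc _ _
      _ = c ^ k := by simp
  obtain ⟨k, hk⟩ := hev.exists
  refine ⟨k, fun m => tens (rot (θ m)) k, fun m y z => ?_, hk⟩
  rw [sum_tens_mul_tens_eq (sum_rot_self (θ m)), one_pow]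

end Tensor

section Frames

variable {ρ κ : Type*} [Fintype ρ] [Fintype κ]

theorem sum_norm_sq_eq_of_gram [DecidableEq κ] {G : ρ → κ → ℝ} {c : ℝ}
    (hG : ∀ j j', ∑ i, G i j * G i j' = if j = j' then c else 0) {H : Type*}
    [NormedAddCommGroup H] [InnerProductSpace ℝ H] (β : κ → H) :
    ∑ i, ‖∑ j, G i j • β j‖ ^ 2 = c * ∑ j, ‖β j‖ ^ 2 := by
  have h1 : ∀ i, ‖∑ j, G i j • β j‖ ^ 2 =
      ∑ j, ∑ j', G i j * G i j' * inner ℝ (β j) (β j') := fun i => by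
    rw [← real_inner_self_eq_norm_sq, sum_inner]
    refine Finset.sum_congr rfl fun j _ => ?_
    rw [inner_sum]
    refine Finset.sum_congr rfl fun j' _ => ?_
    rw [real_inner_smul_left, real_inner_smul_right]
    ring
  simp only [h1]
  rw [Finset.sum_comm, Finset.mul_sum]
  refine Finset.sum_congr rfl fun j _ => ?_
  rw [Finset.sum_comm]
  simp only [← Finset.sum_mul, hG]
  simp

/-- An incoherent family of unit vectors which is a frame with upper bound `D` is bounded from
`ℓ_r` to `ℓ_2` by an absolute constant: the coefficients below the level `t` are controlled by the
frame bound, the few above it by the incoherence. -/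
theorem eucl_frame_le {G : ρ → κ → ℝ} {D μ t r : ℝ} (hr1 : 1 ≤ r) (hr2 : r ≤ 2) (ht : 0 < t)
    (hD0 : 0 ≤ D) (hμ0 : 0 ≤ μ)
    (hD : ∀ u, eucl (fun i => ∑ j, G i j * u j) ^ 2 ≤ D * eucl u ^ 2)
    (hdiag : ∀ j, ∑ i, G i j * G i j = 1) (hμ : ∀ j j', j ≠ j' → |∑ i, G i j * G i j'| ≤ μ)
    (hDt : D * t ^ (2 - r) ≤ 1) (hμt : μ * (t ^ (1 - r)) ^ 2 ≤ 1) (u : κ → ℝ) :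
    eucl (fun i => ∑ j, G i j * u j) ≤ 3 * lpn r u := by
  classical
  have hr0 : 0 < r := by linarith
  have key : ∀ u : κ → ℝ, ∑ j, |u j| ^ r = 1 → eucl (fun i => ∑ j, G i j * u j) ≤ 3 := by
    intro u hu
    have hu1 : ∀ j, |u j| ≤ 1 := fun j => by
      have h1 : |u j| ^ r ≤ 1 := by
        rw [← hu]
        exact Finset.single_le_sum (f := fun j => |u j| ^ r) (fun j _ => by positivity)
          (Finset.mem_univ j)
      by_contra! h
      exact absurd (Real.one_lt_rpow h hr0) (not_lt.2 h1)
    let v : κ → ℝ := fun j => if t < |u j| then u j else 0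
    let w : κ → ℝ := fun j => if t < |u j| then 0 else u j
    have huvw : ∀ j, u j = v j + w j := fun j => by
      simp only [v, w]; split_ifs <;> simp
    have hw : eucl (fun i => ∑ j, G i j * w j) ^ 2 ≤ 1 := by
      refine (hD w).trans (le_trans ?_ hDt)
      gcongr
      rw [eucl_sq]
      calc ∑ j, w j ^ 2 ≤ ∑ j, t ^ (2 - r) * |u j| ^ r := by
            refine Finset.sum_le_sum fun j _ => ?_
            simp only [w]
            split_ifs with h
            · rw [zero_pow two_ne_zero]; positivity
            · push Not at h
              calc u j ^ 2 = |u j| ^ (2 - r) * |u j| ^ r := by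
                    rw [← Real.rpow_add_of_nonneg (abs_nonneg _) (by linarith) hr0.le,
                      sub_add_cancel, Real.rpow_ofNat, sq_abs]
                _ ≤ t ^ (2 - r) * |u j| ^ r := by
                    gcongr
        _ = t ^ (2 - r) := by rw [← Finset.mul_sum, hu, mul_one]
    have hv1 : ∑ j, |v j| ≤ t ^ (1 - r) := by
      calc ∑ j, |v j| ≤ ∑ j, t ^ (1 - r) * |u j| ^ r := by
            refine Finset.sum_le_sum fun j _ => ?_
            simp only [v]
            split_ifs with h
            · have h0 : 0 < |u j| := ht.trans h
              calc |u j| = |u j| ^ (1 - r) * |u j| ^ r := by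
                    rw [← Real.rpow_add h0, sub_add_cancel, Real.rpow_one]
                _ ≤ t ^ (1 - r) * |u j| ^ r := by
                    gcongr ?_ * _
                    exact Real.rpow_le_rpow_of_nonpos ht h.le (by linarith)
            · rw [abs_zero]; positivity
        _ = t ^ (1 - r) := by rw [← Finset.mul_sum, hu, mul_one]
    have hv2 : ∑ j, v j ^ 2 ≤ 1 := by
      rw [← hu]
      refine Finset.sum_le_sum fun j _ => ?_
      simp only [v]
      split_ifs with h
      · rw [← sq_abs, ← Real.rpow_natCast]
        exact Real.rpow_le_rpow_of_exponent_ge (ht.trans h) (hu1 j) (by simpa using hr2)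
      · rw [zero_pow two_ne_zero]; positivity
    have hv : eucl (fun i => ∑ j, G i j * v j) ^ 2 ≤ 2 := by
      have h1 : eucl (fun i => ∑ j, G i j * v j) ^ 2 =
          ∑ j, ∑ j', v j * v j' * ∑ i, G i j * G i j' := by
        have h2 : ∀ i, (∑ j, G i j * v j) ^ 2 =
            ∑ j, ∑ j', v j * v j' * (G i j * G i j') := fun i => by
          rw [sq, Finset.sum_mul_sum]
          exact Finset.sum_congr rfl fun j _ => Finset.sum_congr rfl fun j' _ => by ring
        simp only [eucl_sq, h2, Finset.mul_sum]
        rw [Finset.sum_comm]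
        exact Finset.sum_congr rfl fun j _ => Finset.sum_comm
      have h2 : ∀ j j', v j * v j' * ∑ i, G i j * G i j' ≤
          (if j = j' then v j ^ 2 else 0) + μ * (|v j| * |v j'|) := fun j j' => by
        split_ifs with h
        · subst h
          rw [hdiag, mul_one, ← sq]
          have : 0 ≤ μ * (|v j| * |v j|) := by positivity
          linarith
        · rw [zero_add]
          refine (le_abs_self _).trans ?_
          rw [abs_mul, abs_mul, mul_comm μ]
          gcongr
          exact hμ j j' h
      rw [h1]
      calc _ ≤ ∑ j, ∑ j', ((if j = j' then v j ^ 2 else 0) + μ * (|v j| * |v j'|)) :=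
            Finset.sum_le_sum fun j _ => Finset.sum_le_sum fun j' _ => h2 j j'
        _ = ∑ j, v j ^ 2 + μ * (∑ j, |v j|) ^ 2 := by
            simp only [Finset.sum_add_distrib, ← Finset.mul_sum, sq (∑ j, |v j|),
              Finset.sum_mul_sum]
            simp
        _ ≤ 1 + μ * (t ^ (1 - r)) ^ 2 := by gcongr
        _ ≤ 2 := by linarith
    have hsum : eucl (fun i => ∑ j, G i j * u j) ^ 2 ≤
        2 * eucl (fun i => ∑ j, G i j * v j) ^ 2 + 2 * eucl (fun i => ∑ j, G i j * w j) ^ 2 := by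
      simp only [eucl_sq, Finset.mul_sum (s := Finset.univ (α := ρ)), ← Finset.sum_add_distrib]
      refine Finset.sum_le_sum fun i _ => ?_
      have : ∑ j, G i j * u j = ∑ j, G i j * v j + ∑ j, G i j * w j := by
        rw [← Finset.sum_add_distrib]
        exact Finset.sum_congr rfl fun j _ => by rw [huvw j]; ring
      rw [this]
      nlinarith [sq_nonneg (∑ j, G i j * v j - ∑ j, G i j * w j)]
    nlinarith [eucl_nonneg fun i => ∑ j, G i j * u j]
  rcases (lpn_nonneg r u).eq_or_lt with h0 | h0
  · have h1 : ∑ j, |u j| ^ r = 0 := by rw [← lpn_rpow hr0, ← h0, Real.zero_rpow hr0.ne']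
    have h2 : ∀ j, u j = 0 := fun j => by
      have := (Finset.sum_eq_zero_iff_of_nonneg fun i _ => by positivity).1 h1 j
        (Finset.mem_univ j)
      simpa [Real.rpow_eq_zero_iff_of_nonneg (abs_nonneg _), hr0.ne'] using this
    simp [h2, eucl, ← h0]
  · have h1 := key (fun j => (lpn r u)⁻¹ * u j) (by
      simp only [abs_mul, Real.mul_rpow (abs_nonneg _) (abs_nonneg _), ← Finset.mul_sum]
      rw [← lpn_rpow hr0, ← Real.mul_rpow (abs_nonneg _) h0.le, abs_of_pos (by positivity),
        inv_mul_cancel₀ h0.ne', Real.one_rpow])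
    have h2 : ∀ i, ∑ j, G i j * ((lpn r u)⁻¹ * u j) = (lpn r u)⁻¹ * ∑ j, G i j * u j := fun i => by
      rw [Finset.mul_sum]
      exact Finset.sum_congr rfl fun j _ => by ring
    simp only [h2] at h1
    rw [eucl_smul (by positivity), inv_mul_le_iff₀ h0] at h1
    linarith

end Frames

/-! ### A finitely strictly singular operator outside `J^{ℓ_2}` -/

section ProductSystem

variable {Λ ι : Type} [Fintype Λ] [Fintype ι] [DecidableEq ι]

/-- The element of `ℓ_r(Λ × {±1}^ι)` corresponding to `c ∈ ℓ_r^Λ(ℓ_2^ι)` under the Rademacher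
embedding of `ℓ_2^ι`, normalized by averaging over `Λ`. -/
noncomputable def prodRad (r : ℝ) (c : Λ → ι → ℝ) (z : Λ × (ι → Bool)) : ℝ :=
  (Fintype.card Λ : ℝ) ^ (-(1 / r)) * ∑ i, c z.1 i * radCol r i z.2

theorem lpn_prodRad_le [Nonempty Λ] {r K D : ℝ} (hr : 0 < r) (hK : 0 ≤ K) (hD : 0 ≤ D)
    (hrad : ∀ a : ι → ℝ, lpn r (fun w => ∑ i, a i * radCol r i w) ≤ K * eucl a)
    {c : Λ → ι → ℝ} (hc : ∀ l, eucl (c l) ≤ D) : lpn r (prodRad r c) ≤ K * D := by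
  rw [lpn_le_iff hr _ (by positivity), Fintype.sum_prod_type]
  have ha : (0 : ℝ) < Fintype.card Λ := by exact_mod_cast Fintype.card_pos
  have h1 : ∀ l, ∑ w, |prodRad r c (l, w)| ^ r ≤ (Fintype.card Λ : ℝ)⁻¹ * (K * D) ^ r := by
    intro l
    have h2 : ∀ w, |prodRad r c (l, w)| ^ r =
        (Fintype.card Λ : ℝ)⁻¹ * |∑ i, c l i * radCol r i w| ^ r := fun w => by
      rw [prodRad, abs_mul, abs_of_pos (by positivity), Real.mul_rpow (by positivity)
        (abs_nonneg _), ← Real.rpow_mul ha.le, neg_mul, one_div_mul_cancel hr.ne',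
        Real.rpow_neg_one]
    simp only [h2, ← Finset.mul_sum]
    rw [← lpn_rpow hr]
    gcongr
    · exact lpn_nonneg _ _
    · exact (hrad _).trans (by gcongr; exact hc l)
  calc _ ≤ ∑ _l : Λ, (Fintype.card Λ : ℝ)⁻¹ * (K * D) ^ r := Finset.sum_le_sum fun l _ => h1 l
    _ = (K * D) ^ r := by
        rw [Finset.sum_const, Finset.card_univ, nsmul_eq_mul, mul_inv_cancel_left₀ ha.ne']

theorem sum_prodRad_mul_prodRad [Nonempty Λ] {r r' : ℝ} (h : r.HolderConjugate r')
    (c d : Λ → ι → ℝ) : ∑ z, prodRad r c z * prodRad r' d z =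
      (Fintype.card Λ : ℝ)⁻¹ * ∑ l, ∑ i, c l i * d l i := by
  have ha : (0 : ℝ) < Fintype.card Λ := by exact_mod_cast Fintype.card_pos
  have hN : (Fintype.card Λ : ℝ) ^ (-(1 / r)) * (Fintype.card Λ : ℝ) ^ (-(1 / r')) =
      (Fintype.card Λ : ℝ)⁻¹ := by
    rw [← Real.rpow_add ha, ← neg_add, h.one_div_add_one_div, one_div_one, Real.rpow_neg_one]
  rw [Fintype.sum_prod_type, Finset.mul_sum]
  refine Finset.sum_congr rfl fun l _ => ?_
  have h1 : ∀ w, prodRad r c (l, w) * prodRad r' d (l, w) = (Fintype.card Λ : ℝ)⁻¹ *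
      ∑ i, ∑ j, c l i * d l j * (radCol r i w * radCol r' j w) := fun w => by
    rw [← hN, prodRad, prodRad, mul_mul_mul_comm, Finset.sum_mul_sum]
    congr 1
    exact Finset.sum_congr rfl fun i _ => Finset.sum_congr rfl fun j _ => by ring
  simp only [h1, ← Finset.mul_sum]
  congr 1
  rw [Finset.sum_comm]
  refine Finset.sum_congr rfl fun i _ => ?_
  rw [Finset.sum_comm]
  simp only [← Finset.mul_sum, sum_radCol_mul_radCol h]
  simp

end ProductSystem

section BlockMatrix

variable {Λ ι : Type} [Fintype ι] [DecidableEq ι]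

/-- The block matrix `(ε l m • O m)` with rows `(l, i)` and columns `(m, j)`. -/
def twist (ε : Λ → Λ → ℝ) (O : Λ → ι → ι → ℝ) (l : Λ) (i : ι) (z : Λ × ι) : ℝ :=
  ε l z.1 * O z.1 i z.2

variable {ε : Λ → Λ → ℝ} {O : Λ → ι → ι → ℝ}

theorem sum_twist_sq (hε : ∀ l m, |ε l m| = 1)
    (hO : ∀ m y z, ∑ x, O m x y * O m x z = if y = z then 1 else 0) (l : Λ) (z : Λ × ι) :
    ∑ i, twist ε O l i z * twist ε O l i z = 1 := by
  have h1 : ∀ i, twist ε O l i z * twist ε O l i z = O z.1 i z.2 * O z.1 i z.2 := fun i => by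
    have : ε l z.1 * ε l z.1 = 1 := by rw [← abs_mul_abs_self, hε, mul_one]
    rw [twist, mul_mul_mul_comm, this, one_mul]
  simp only [h1, hO, if_true]

variable [Fintype Λ] [DecidableEq Λ]

theorem gram_twist (hε : ∀ m m', ∑ l, ε l m * ε l m' = if m = m' then (Fintype.card Λ : ℝ) else 0)
    (hO : ∀ m y z, ∑ x, O m x y * O m x z = if y = z then 1 else 0) (z z' : Λ × ι) :
    ∑ y : Λ × ι, twist ε O y.1 y.2 z * twist ε O y.1 y.2 z' =
      if z = z' then (Fintype.card Λ : ℝ) else 0 := by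
  have h1 : ∀ l i, twist ε O l i z * twist ε O l i z' =
      ε l z.1 * ε l z'.1 * (O z.1 i z.2 * O z'.1 i z'.2) := fun l i => by
    simp only [twist]; ring
  rw [Fintype.sum_prod_type]
  simp only [h1, ← Finset.mul_sum, ← Finset.sum_mul, hε]
  by_cases h : z.1 = z'.1
  · rw [if_pos h, ← h, hO]
    by_cases h2 : z.2 = z'.2
    · rw [if_pos h2, if_pos (Prod.ext h h2), mul_one]
    · rw [if_neg h2, if_neg fun h3 => h2 (congrArg Prod.snd h3), mul_zero]
  · rw [if_neg h, zero_mul, if_neg fun h3 => h (congrArg Prod.fst h3)]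

/-- Each row of blocks of the twisted matrix is bounded from `ℓ_r` to `ℓ_2` by an absolute
constant. -/
theorem eucl_twist_le (hε : ∀ l m, |ε l m| = 1)
    (hO : ∀ m y z, ∑ x, O m x y * O m x z = if y = z then 1 else 0) {t r : ℝ} (hr1 : 1 ≤ r)
    (hr2 : r ≤ 2) (ht : 0 < t)
    (hμ : ∀ m m', m ≠ m' → ∀ y z, |∑ x, O m x y * O m' x z| ≤ ((t ^ (1 - r)) ^ 2)⁻¹)
    (hDt : Fintype.card Λ * t ^ (2 - r) ≤ 1) (l : Λ) (u : Λ × ι → ℝ) :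
    eucl (fun i => ∑ z, twist ε O l i z * u z) ≤ 3 * lpn r u := by
  refine eucl_frame_le hr1 hr2 ht (Nat.cast_nonneg _) (μ := ((t ^ (1 - r)) ^ 2)⁻¹) (by positivity)
    (fun u => ?_) (sum_twist_sq hε hO l) (fun z z' hz => ?_) hDt
    (inv_mul_cancel₀ (by positivity)).le u
  · have h1 : ∀ i, (∑ z, twist ε O l i z * u z) ^ 2 ≤
        Fintype.card Λ * ∑ m, (∑ j, O m i j * u (m, j)) ^ 2 := fun i => by
      have h2 : ∑ z, twist ε O l i z * u z = ∑ m, ε l m * ∑ j, O m i j * u (m, j) := by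
        rw [Fintype.sum_prod_type]
        simp only [twist, Finset.mul_sum, mul_assoc]
      rw [h2]
      refine sq_sum_le_card_mul_sum_sq.trans_eq ?_
      rw [Finset.card_univ]
      congr 1
      refine Finset.sum_congr rfl fun m _ => ?_
      rw [mul_pow, ← sq_abs (ε l m), hε, one_pow, one_mul]
    have h3 : ∀ m, ∑ i, (∑ j, O m i j * u (m, j)) ^ 2 = ∑ j, u (m, j) ^ 2 := fun m => by
      have := sum_norm_sq_eq_of_gram (hO m) fun j => u (m, j)
      simpa using this
    rw [eucl_sq, eucl_sq, Fintype.sum_prod_type]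
    refine (Finset.sum_le_sum fun i _ => h1 i).trans_eq ?_
    rw [← Finset.mul_sum, Finset.sum_comm]
    simp only [h3]
  · have h1 : ∀ i, twist ε O l i z * twist ε O l i z' =
        ε l z.1 * ε l z'.1 * (O z.1 i z.2 * O z'.1 i z'.2) := fun i => by
      simp only [twist]; ring
    simp only [h1, ← Finset.mul_sum]
    rw [abs_mul, abs_mul, hε, hε, one_mul, one_mul]
    by_cases h : z.1 = z'.1
    · rw [← h, hO, if_neg fun h2 => hz (Prod.ext h h2), abs_zero]
      positivity
    · exact hμ _ _ h _ _

end BlockMatrix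

/-- There is an operator `ℓ_p → ℓ_q` that factors through a formal inclusion `I(p,r)` with
`p < r < 2` but is not in `J^{ℓ_2}`. Its blocks map the unit vectors of `ℓ_r^{ab}` to `ℓ_q^a(ℓ_2^b)`
by `(m, j) ↦ (a^{-1/q} ε l m • O m e_j)_l`, with a Hadamard matrix `ε` and incoherent orthonormal
bases `O m`. They are bounded from `ℓ_r` because every row of blocks is, by incoherence; but on
`ℓ_2` the whole matrix is a multiple of an isometry, so its trace pairing with operators that
factor through `ℓ_2` is small. -/
theorem exists_fss_notMem_factorIdeal_id {p q : ℝ≥0∞} [Fact (1 ≤ p)] [Fact (1 ≤ q)]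
    (hp2 : p < 2) (h2q : 2 < q) (hq : q ≠ ∞) : ∃ T : Ell p →L[ℝ] Ell q,
      FinitelyStrictlySingular T ∧
        T ∉ factorIdeal (Ell p) (Ell q) (ContinuousLinearMap.id ℝ (Ell 2)) := by
  obtain ⟨r, hpr, hr2⟩ := exists_between hp2
  have : Fact (1 ≤ r) := ⟨(Fact.out : 1 ≤ p).trans hpr.le⟩
  have hp : p ≠ ∞ := hp2.ne_top
  have hr : r ≠ ∞ := hr2.ne_top
  have hR1 : 1 ≤ r.toReal := by
    simpa using (ENNReal.toReal_le_toReal ENNReal.one_ne_top hr).2 (Fact.out : 1 ≤ r)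
  have hR2 : r.toReal < 2 := by simpa using (ENNReal.toReal_lt_toReal hr (by simp)).2 hr2
  have hQ2 : 2 < q.toReal := by simpa using (ENNReal.toReal_lt_toReal (by simp) hq).2 h2q
  have hQ0 : 0 < q.toReal := by linarith
  have hqq := (Real.HolderConjugate.conjExponent (by linarith : 1 < q.toReal)).symm
  set q' := Real.conjExponent q.toReal
  have hq2 : q' ≤ 2 := holderConjugate_le_two hqq hQ2.le
  have hK := khC_pos hQ0
  let Λ : ℕ → Type := fun s => Fin s → Bool
  let a : ℕ → ℝ := fun s => 2 ^ s
  have ha : ∀ s, (Fintype.card (Λ s) : ℝ) = a s := fun s => by simp [Λ, a]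
  have ha0 : ∀ s, 0 < a s := fun s => by positivity
  -- the level at which coefficients are split: the frame bound of a row of blocks is `a s`
  let t : ℕ → ℝ := fun s => (a s) ^ (-(2 - r.toReal)⁻¹)
  have ht : ∀ s, 0 < t s := fun s => Real.rpow_pos_of_pos (ha0 s) _
  have hDt : ∀ s, a s * t s ^ (2 - r.toReal) = 1 := fun s => by
    rw [← Real.rpow_mul (ha0 s).le, neg_mul, inv_mul_cancel₀ (by linarith), Real.rpow_neg_one,
      mul_inv_cancel₀ (ha0 s).ne']
  have hex := fun s => exists_incoherent_bases (Λ s) (μ := ((t s ^ (1 - r.toReal)) ^ 2)⁻¹)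
    (by have := Real.rpow_pos_of_pos (ht s) (1 - r.toReal); positivity)
  choose k O hO hμ using hex
  let ε : ∀ s, Λ s → Λ s → ℝ := fun s => tens had s
  have hε1 : ∀ s l m, |ε s l m| = 1 := fun s => abs_tens_had s
  have hε2 : ∀ s m m', ∑ l, ε s l m * ε s l m' =
      if m = m' then (Fintype.card (Λ s) : ℝ) else 0 := fun s m m' => by
    rw [ha]; exact sum_tens_mul_tens_eq sum_had s m m'
  let J : ℕ → Type := fun s => Λ s × (Fin (k s) → Bool)
  let I : ℕ → Type := fun s => Λ s × ((Fin (k s) → Bool) → Bool)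
  have hcol : ∀ s (z : J s) l, eucl (fun i => twist (ε s) (O s) l i z) ≤ 1 := fun s z l => by
    refine Real.sqrt_le_one.2 ?_
    simp only [sq]
    exact (sum_twist_sq (hε1 s) (hO s) l z).le
  obtain ⟨U, hU⟩ := exists_block_operator (J := J) (I := I) (hr2.trans h2q).le hq
    (fun s y z => prodRad q.toReal (fun l i => twist (ε s) (O s) l i z) y)
    (C := khC q.toReal ^ (1 / q.toReal) * 3) (by positivity) (fun s u => by
      have h1 : (fun y => ∑ z, prodRad q.toReal (fun l i => twist (ε s) (O s) l i z) y * u z) =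
          prodRad q.toReal (fun l i => ∑ z, twist (ε s) (O s) l i z * u z) := by
        ext y
        simp only [prodRad, Finset.mul_sum, Finset.sum_mul]
        rw [Finset.sum_comm]
        exact Finset.sum_congr rfl fun i _ => Finset.sum_congr rfl fun z _ => by ring
      rw [h1, mul_assoc]
      refine lpn_prodRad_le hQ0 (by positivity) (mul_nonneg (by norm_num) (lpn_nonneg _ _))
        (lpn_radCol_le hQ0) fun l => ?_
      exact eucl_twist_le (hε1 s) (hO s) hR1 hR2.le (ht s) (hμ s) (by rw [ha, hDt]) l u)
  refine ⟨U ∘L formalInclusion p r hpr.le, (fss_formalInclusion hp2.le hpr hr).comp_left U, ?_⟩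
  let L : ∀ s, J s → Ell q →L[ℝ] ℝ := fun s z =>
    blockFun (I := I) q s (prodRad q' fun l i => twist (ε s) (O s) l i z)
  let x : ∀ s, J s → Ell p := fun s z => blockVec p s fun j => if j = z then 1 else 0
  have hx : ∀ s z, ‖x s z‖ = 1 := fun s z => norm_blockVec_ite hp s z
  have hL : ∀ s z y, |L s z y| ≤ ‖y‖ := fun s z y => by
    refine (abs_blockFun_le hq hqq s _ y).trans (mul_le_of_le_one_left (norm_nonneg _) ?_)
    refine (lpn_prodRad_le hqq.pos zero_le_one zero_le_one (fun c => ?_) (hcol s z)).trans_eq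
      (one_mul 1)
    rw [one_mul]
    exact lpn_radCol_le_of_le_two hqq.pos hq2 c
  refine notMem_factorIdeal_of_pairing hL (fun s z => (hx s z).le) (fun A' B' => ?_)
    (fun s z => ?_)
  · have hlim : Tendsto (fun s : ℕ => ‖A'‖ * ‖B'‖ * a s ^ (-(1 / q' - 1 / 2))) atTop (𝓝 0) := by
      have h1 : 0 < 1 / q' - 1 / 2 := by
        have h2 := hqq.one_div_add_one_div
        have h3 : 1 / q.toReal < 1 / 2 := one_div_lt_one_div_of_lt two_pos hQ2
        linarith
      have h2 := (tendsto_rpow_neg_atTop h1).comp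
        (tendsto_pow_atTop_atTop_of_one_lt (one_lt_two (α := ℝ)))
      simpa using h2.const_mul (‖A'‖ * ‖B'‖)
    refine squeeze_zero_norm (fun s => ?_) hlim
    -- the functionals `f l i` are the normalized Rademacher functions in the `l`-th copy
    let f : Λ s → (Fin (k s) → Bool) → Ell q →L[ℝ] ℝ := fun l i =>
      blockFun (I := I) q s fun y => if y.1 = l then radCol q' i y.2 else 0
    have hf : ∀ l i y, |f l i y| ≤ ‖y‖ := fun l i y => by
      refine (abs_blockFun_le hq hqq s _ y).trans (mul_le_of_le_one_left (norm_nonneg _) ?_)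
      refine le_trans (le_of_eq ?_) (lpn_radCol_self_le hqq.pos hq2 i)
      rw [lpn, lpn, Fintype.sum_prod_type, Finset.sum_eq_single l]
      · simp
      · intro l' _ hl'
        simp [hl', hqq.ne_zero]
      · simp
    have hLf : ∀ z y, L s z y = a s ^ (-(1 / q')) *
        ∑ l, ∑ i, twist (ε s) (O s) l i z * f l i y := fun z y => by
      simp only [L, f, blockFun_apply, prodRad, ha, Finset.mul_sum, Finset.sum_mul]
      rw [Fintype.sum_prod_type]
      refine Finset.sum_congr rfl fun l _ => ?_
      rw [Finset.sum_comm]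
      refine Finset.sum_congr rfl fun i _ => ?_
      rw [Fintype.sum_prod_type, Finset.sum_eq_single l]
      · exact Finset.sum_congr rfl fun w _ => by simp; ring
      · intro l' _ hl'
        simp [hl']
      · simp
    let γ : Λ s × (Fin (k s) → Bool) → Ell 2 := fun y =>
      ∑ z, twist (ε s) (O s) y.1 y.2 z • B' (x s z)
    set N : ℝ := (Fintype.card (J s) : ℝ) with hN
    have hN0 : 0 < N := by
      have : 0 < Fintype.card (J s) := Fintype.card_pos
      rw [hN]
      exact_mod_cast this
    have hsum : ∑ z, L s z ((A' ∘L ContinuousLinearMap.id ℝ (Ell 2) ∘L B') (x s z)) =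
        a s ^ (-(1 / q')) * ∑ y, f y.1 y.2 (A' (γ y)) := by
      simp only [hLf, γ, map_sum, map_smul, ContinuousLinearMap.comp_apply,
        ContinuousLinearMap.id_apply, ← Finset.mul_sum, smul_eq_mul]
      congr 1
      rw [Finset.sum_comm' (t' := Finset.univ) (s' := fun _ => Finset.univ) (by simp),
        Fintype.sum_prod_type]
      exact Finset.sum_congr rfl fun l _ => Finset.sum_comm
    have hγ : ∑ y, ‖γ y‖ ^ 2 ≤ a s * (N * ‖B'‖ ^ 2) := by
      have h1 := sum_norm_sq_eq_of_gram (G := fun (y z : J s) => twist (ε s) (O s) y.1 y.2 z)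
        (gram_twist (hε2 s) (hO s)) fun z => B' (x s z)
      rw [ha] at h1
      refine h1.trans_le ?_
      gcongr
      calc ∑ z, ‖B' (x s z)‖ ^ 2 ≤ ∑ _z : J s, ‖B'‖ ^ 2 := by
            refine Finset.sum_le_sum fun z _ => ?_
            gcongr
            simpa [hx] using B'.le_opNorm (x s z)
        _ = N * ‖B'‖ ^ 2 := by simp [hN]
    have hγ1 : ∑ y, ‖γ y‖ ≤ N * √(a s) * ‖B'‖ := by
      refine abs_le_of_sq_le_sq' (b := N * √(a s) * ‖B'‖) ?_ (by positivity) |>.2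
      calc (∑ y, ‖γ y‖) ^ 2 ≤ N * ∑ y, ‖γ y‖ ^ 2 := by
            have := sq_sum_le_card_mul_sum_sq (s := Finset.univ) (f := fun y => ‖γ y‖)
            rwa [Finset.card_univ] at this
        _ ≤ N * (a s * (N * ‖B'‖ ^ 2)) := by gcongr
        _ = (N * √(a s) * ‖B'‖) ^ 2 := by
            rw [mul_pow, mul_pow, Real.sq_sqrt (ha0 s).le]; ring
    rw [meanPairing_apply, hsum, Real.norm_eq_abs, abs_mul, abs_of_pos (by positivity),
      inv_mul_le_iff₀ hN0, abs_mul, abs_of_pos (Real.rpow_pos_of_pos (ha0 s) _)]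
    have h1 : |∑ y, f y.1 y.2 (A' (γ y))| ≤ ‖A'‖ * (N * √(a s) * ‖B'‖) := by
      refine (Finset.abs_sum_le_sum_abs _ _).trans (le_trans ?_
        (mul_le_mul_of_nonneg_left hγ1 (norm_nonneg A')))
      rw [Finset.mul_sum]
      exact Finset.sum_le_sum fun y _ => (hf _ _ _).trans (A'.le_opNorm _)
    calc a s ^ (-(1 / q')) * |∑ y, f y.1 y.2 (A' (γ y))|
        ≤ a s ^ (-(1 / q')) * (‖A'‖ * (N * √(a s) * ‖B'‖)) := by
          have := Real.rpow_pos_of_pos (ha0 s) (-(1 / q'))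
          gcongr
      _ = N * (‖A'‖ * ‖B'‖ * (a s ^ (-(1 / q')) * √(a s))) := by ring
      _ = N * (‖A'‖ * ‖B'‖ * a s ^ (-(1 / q' - 1 / 2))) := by
          rw [Real.sqrt_eq_rpow, ← Real.rpow_add (ha0 s)]
          congr 3
          ring
  · have h1 : ∀ y, (U ∘L formalInclusion p r hpr.le) (x s z) (idx I ⟨s, y⟩) =
        prodRad q.toReal (fun l i => twist (ε s) (O s) l i z) y := fun y => by
      simp only [ContinuousLinearMap.comp_apply, hU, formalInclusion_apply, x, blockVec_apply]
      simp
    simp only [L, blockFun_apply, h1]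
    rw [sum_prodRad_mul_prodRad hqq]
    simp only [sum_twist_sq (hε1 s) (hO s)]
    have := (ha0 s).ne'
    rw [Finset.sum_const, Finset.card_univ, nsmul_eq_mul, ha, mul_one, inv_mul_cancel₀ this]

/-! ### Seven closed subideals -/

theorem formalInclusion_comp {p r s : ℝ≥0∞} [Fact (1 ≤ p)] [Fact (1 ≤ r)] [Fact (1 ≤ s)]
    (h : p ≤ r) (h' : r ≤ s) :
    formalInclusion r s h' ∘L formalInclusion p r h = formalInclusion p s (h.trans h') := by
  ext x k
  simp only [ContinuousLinearMap.comp_apply, formalInclusion_apply]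

theorem formalInclusion_mem_factorIdeal {p q : ℝ≥0∞} [Fact (1 ≤ p)] [Fact (1 ≤ q)] (h : p ≤ q) :
    formalInclusion p q h ∈ factorIdeal (Ell p) (Ell q) (formalInclusion p q h) := by
  have h1 := comp_mem_factorIdeal_left (formalInclusion p q h) (ContinuousLinearMap.id ℝ (Ell q))
  rwa [ContinuousLinearMap.id_comp] at h1

theorem factorIdeal_p_q_le_p_two {p q : ℝ≥0∞} [Fact (1 ≤ p)] [Fact (1 ≤ q)] (hp2 : p ≤ 2)
    (h2q : 2 ≤ q) : factorIdeal (Ell p) (Ell q) (formalInclusion p q (hp2.trans h2q)) ≤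
      factorIdeal (Ell p) (Ell q) (formalInclusion p 2 hp2) := by
  rw [← formalInclusion_comp hp2 h2q]
  have h := factorIdeal_comp_le (X := Ell p) (Y := Ell q) (formalInclusion 2 q h2q)
    (formalInclusion p 2 hp2) (ContinuousLinearMap.id ℝ (Ell p))
  rwa [ContinuousLinearMap.comp_id] at h

theorem factorIdeal_p_q_le_two_q {p q : ℝ≥0∞} [Fact (1 ≤ p)] [Fact (1 ≤ q)] (hp2 : p ≤ 2)
    (h2q : 2 ≤ q) : factorIdeal (Ell p) (Ell q) (formalInclusion p q (hp2.trans h2q)) ≤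
      factorIdeal (Ell p) (Ell q) (formalInclusion 2 q h2q) := by
  rw [← formalInclusion_comp hp2 h2q]
  have h := factorIdeal_comp_le (X := Ell p) (Y := Ell q) (ContinuousLinearMap.id ℝ (Ell q))
    (formalInclusion 2 q h2q) (formalInclusion p 2 hp2)
  rwa [ContinuousLinearMap.id_comp] at h

theorem factorIdeal_le_factorIdeal_id_dom {X Y W Z : Type*}
    [NormedAddCommGroup X] [NormedSpace ℝ X] [NormedAddCommGroup Y] [NormedSpace ℝ Y]
    [NormedAddCommGroup W] [NormedSpace ℝ W] [NormedAddCommGroup Z] [NormedSpace ℝ Z]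
    (S : W →L[ℝ] Z) : factorIdeal X Y S ≤ factorIdeal X Y (ContinuousLinearMap.id ℝ W) := by
  have h := factorIdeal_comp_le (X := X) (Y := Y) S (ContinuousLinearMap.id ℝ W)
    (ContinuousLinearMap.id ℝ W)
  rwa [ContinuousLinearMap.id_comp, ContinuousLinearMap.comp_id] at h

theorem factorIdeal_le_factorIdeal_id_cod {X Y W Z : Type*}
    [NormedAddCommGroup X] [NormedSpace ℝ X] [NormedAddCommGroup Y] [NormedSpace ℝ Y]
    [NormedAddCommGroup W] [NormedSpace ℝ W] [NormedAddCommGroup Z] [NormedSpace ℝ Z]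
    (S : W →L[ℝ] Z) : factorIdeal X Y S ≤ factorIdeal X Y (ContinuousLinearMap.id ℝ Z) := by
  have h := factorIdeal_comp_le (X := X) (Y := Y) (ContinuousLinearMap.id ℝ Z)
    (ContinuousLinearMap.id ℝ Z) S
  rwa [ContinuousLinearMap.id_comp, ContinuousLinearMap.id_comp] at h

/-- The ideal `J^ℝ` is the closure of the finite rank operators; on these, the diagonal matrix
entries tend to zero, whereas they are all equal to one for the formal inclusion. -/
theorem formalInclusion_notMem_factorIdeal_real {p q : ℝ≥0∞} [Fact (1 ≤ p)] [Fact (1 ≤ q)]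
    (h : p ≤ q) (hq : q ≠ ∞) : formalInclusion p q h ∉
      factorIdeal (Ell p) (Ell q) (ContinuousLinearMap.id ℝ ℝ) := by
  have hQ := toReal_pos_of_one_le hq
  refine notMem_factorIdeal_of_pairing (κ := fun _ => Unit)
    (L := fun n _ => lp.evalCLM ℝ (fun _ : ℕ => ℝ) q n)
    (x := fun n _ => lp.single p n (1 : ℝ)) (fun n _ y => abs_apply_le_norm y n)
    (fun n _ => (norm_single_one n).le) (fun A B => ?_) fun n _ => ?_
  · have h1 : Tendsto (fun n => ‖A 1 n‖) atTop (𝓝 0) := by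
      have h2 := (lp.memℓp (A 1)).summable hQ |>.tendsto_atTop_zero
      have h3 := h2.rpow_const (p := 1 / q.toReal) (Or.inr (by positivity))
      rw [Real.zero_rpow (by positivity)] at h3
      refine h3.congr fun n => ?_
      rw [← Real.rpow_mul (norm_nonneg _), mul_one_div_cancel hQ.ne', Real.rpow_one]
    have h2 := h1.const_mul ‖B‖
    rw [mul_zero] at h2
    refine squeeze_zero_norm (fun n => ?_) h2
    have h3 : (A ∘L ContinuousLinearMap.id ℝ ℝ ∘L B) (lp.single p n (1 : ℝ)) =
        B (lp.single p n (1 : ℝ)) • A 1 := by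
      rw [← map_smul, smul_eq_mul, mul_one]; rfl
    have h4 : meanPairing (fun _ : Unit => lp.evalCLM ℝ (fun _ : ℕ => ℝ) q n)
        (fun _ => lp.single p n (1 : ℝ)) (A ∘L ContinuousLinearMap.id ℝ ℝ ∘L B) =
        B (lp.single p n (1 : ℝ)) * A 1 n := by
      rw [meanPairing_apply]
      simp only [h3, Fintype.card_unit, Nat.cast_one, inv_one, one_mul, Finset.univ_unique,
        Finset.sum_singleton]
      rfl
    rw [h4, norm_mul]
    gcongr
    simpa [norm_single_one] using B.le_opNorm (lp.single p n (1 : ℝ))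
  · change formalInclusion p q h (lp.single p n (1 : ℝ)) n = 1
    rw [formalInclusion_apply, lp.single_apply_self]

theorem factorIdeal_real_ne_bot {p q : ℝ≥0∞} [Fact (1 ≤ p)] [Fact (1 ≤ q)] :
    factorIdeal (Ell p) (Ell q) (ContinuousLinearMap.id ℝ ℝ) ≠ ⊥ := by
  intro h
  have h1 := mem_factorIdeal (X := Ell p) (Y := Ell q) (ContinuousLinearMap.id ℝ ℝ)
    (ContinuousLinearMap.toSpanSingleton ℝ (lp.single q 0 (1 : ℝ)))
    (lp.evalCLM ℝ (fun _ : ℕ => ℝ) p 0)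
  rw [h, Submodule.mem_bot] at h1
  have h2 := congrArg (fun T : Ell p →L[ℝ] Ell q => T (lp.single p 0 (1 : ℝ)) 0) h1
  have h3 : (lp.single p 0 (1 : ℝ) : Ell p) 0 • (lp.single q 0 (1 : ℝ) : Ell q) 0 = (0 : ℝ) := h2
  rw [lp.single_apply_self, lp.single_apply_self] at h3
  simp at h3

theorem seven_le_encard {α : Type*} {s : Set α} {a₁ a₂ a₃ a₄ a₅ a₆ a₇ : α}
    (hnd : [a₁, a₂, a₃, a₄, a₅, a₆, a₇].Nodup) (hs : ∀ a ∈ [a₁, a₂, a₃, a₄, a₅, a₆, a₇], a ∈ s) :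
    7 ≤ s.encard := by
  classical
  have h1 : ((([a₁, a₂, a₃, a₄, a₅, a₆, a₇].toFinset : Finset α) : Set α)).encard = 7 := by
    rw [Set.encard_coe_eq_coe_finsetCard, List.toFinset_card_of_nodup hnd]
    rfl
  rw [← h1]
  refine Set.encard_le_encard fun a ha => hs a ?_
  simpa using ha

end OperatorIdeals

open OperatorIdeals in
open scoped ENNReal in
theorem theorem2p1 (p q : ℝ≥0∞) [Fact (1 ≤ p)] [Fact (1 ≤ q)]
    (hp1 : 1 < p) (hp2 : p < 2) (h2q : 2 < q) (hq : q < ∞) :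
    -- the two ideals are closed subideals of `L(ℓ_p, ℓ_q)` contained in `FSS ∩ J^{ℓ_2}`
    IsClosedSubideal (factorIdeal (Ell p) (Ell q) (formalInclusion p 2 hp2.le)) ∧
    IsClosedSubideal (factorIdeal (Ell p) (Ell q) (formalInclusion 2 q h2q.le)) ∧
    (factorIdeal (Ell p) (Ell q) (formalInclusion p 2 hp2.le) : Set (Ell p →L[ℝ] Ell q)) ⊆
      FSS (Ell p) (Ell q) ∩ factorIdeal (Ell p) (Ell q) (ContinuousLinearMap.id ℝ (Ell 2)) ∧
    (factorIdeal (Ell p) (Ell q) (formalInclusion 2 q h2q.le) : Set (Ell p →L[ℝ] Ell q)) ⊆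
      FSS (Ell p) (Ell q) ∩ factorIdeal (Ell p) (Ell q) (ContinuousLinearMap.id ℝ (Ell 2)) ∧
    -- they are incomparable, with witnesses of the form `A ∘ I(p,2)` and `I(2,q) ∘ B`
    IncompRel (· ≤ ·) (factorIdeal (Ell p) (Ell q) (formalInclusion p 2 hp2.le))
      (factorIdeal (Ell p) (Ell q) (formalInclusion 2 q h2q.le)) ∧
    (∃ A : Ell 2 →L[ℝ] Ell q,
      A ∘L formalInclusion p 2 hp2.le ∈
        factorIdeal (Ell p) (Ell q) (formalInclusion p 2 hp2.le) ∧
      A ∘L formalInclusion p 2 hp2.le ∉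
        factorIdeal (Ell p) (Ell q) (formalInclusion 2 q h2q.le)) ∧
    (∃ B : Ell p →L[ℝ] Ell 2,
      formalInclusion 2 q h2q.le ∘L B ∈
        factorIdeal (Ell p) (Ell q) (formalInclusion 2 q h2q.le) ∧
      formalInclusion 2 q h2q.le ∘L B ∉
        factorIdeal (Ell p) (Ell q) (formalInclusion p 2 hp2.le)) ∧
    -- consequently `J^{I(p,q)}` is strictly smaller than `FSS ∩ J^{ℓ_2}`
    (factorIdeal (Ell p) (Ell q) (formalInclusion p q (hp2.trans h2q).le) :
        Set (Ell p →L[ℝ] Ell q)) ⊂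
      FSS (Ell p) (Ell q) ∩ factorIdeal (Ell p) (Ell q) (ContinuousLinearMap.id ℝ (Ell 2)) ∧
    -- and `L(ℓ_p, ℓ_q)` has at least seven nontrivial proper closed subideals
    7 ≤ Set.encard {J : Submodule ℝ (Ell p →L[ℝ] Ell q) |
      IsClosedSubideal J ∧ J ≠ ⊥ ∧ J ≠ ⊤} := by
  set K := factorIdeal (Ell p) (Ell q) (ContinuousLinearMap.id ℝ ℝ) with hK
  set Jpq := factorIdeal (Ell p) (Ell q) (formalInclusion p q (hp2.trans h2q).le) with hJpq
  set Jp := factorIdeal (Ell p) (Ell q) (formalInclusion p 2 hp2.le) with hJp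
  set Jq := factorIdeal (Ell p) (Ell q) (formalInclusion 2 q h2q.le) with hJq
  set H := factorIdeal (Ell p) (Ell q) (ContinuousLinearMap.id ℝ (Ell 2)) with hH
  set F := fssSubmodule (Ell p) (Ell q) with hF
  set V := (Jp ⊔ Jq).topologicalClosure with hV
  have cK : IsClosedSubideal K := isClosedSubideal_factorIdeal _
  have cJpq : IsClosedSubideal Jpq := isClosedSubideal_factorIdeal _
  have cJp : IsClosedSubideal Jp := isClosedSubideal_factorIdeal _
  have cJq : IsClosedSubideal Jq := isClosedSubideal_factorIdeal _
  have cH : IsClosedSubideal H := isClosedSubideal_factorIdeal _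
  have cF : IsClosedSubideal F := isClosedSubideal_fss
  have cV : IsClosedSubideal V := (cJp.1.sup cJq.1).topologicalClosure
  have hpq_p : Jpq ≤ Jp := factorIdeal_p_q_le_p_two hp2.le h2q.le
  have hpq_q : Jpq ≤ Jq := factorIdeal_p_q_le_two_q hp2.le h2q.le
  have hp_F : Jp ≤ F := factorIdeal_le_fss (fss_formalInclusion hp2.le hp2 (by simp))
  have hq_F : Jq ≤ F := factorIdeal_le_fss (fss_formalInclusion le_rfl h2q hq.ne)
  have hp_H : Jp ≤ H := factorIdeal_le_factorIdeal_id_cod _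
  have hq_H : Jq ≤ H := factorIdeal_le_factorIdeal_id_dom _
  have hp_V : Jp ≤ V := le_sup_left.trans (Submodule.le_topologicalClosure _)
  have hq_V : Jq ≤ V := le_sup_right.trans (Submodule.le_topologicalClosure _)
  have hV_F : V ≤ F := Submodule.topologicalClosure_minimal _ (sup_le hp_F hq_F) cF.2
  have hV_H : V ≤ H := Submodule.topologicalClosure_minimal _ (sup_le hp_H hq_H) cH.2
  obtain ⟨A, hA⟩ := exists_notMem_factorIdeal_two_q hp1 hp2.le h2q hq.ne
  obtain ⟨B, hB⟩ := exists_notMem_factorIdeal_p_two hp1 hp2 h2q.le hq.ne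
  have hAp : A ∘L formalInclusion p 2 hp2.le ∈ Jp :=
    comp_mem_factorIdeal_left _ A
  have hBq : formalInclusion 2 q h2q.le ∘L B ∈ Jq :=
    comp_mem_factorIdeal_right _ B
  have hpq : ¬ Jp ≤ Jq := fun h => hA (h hAp)
  have hqp : ¬ Jq ≤ Jp := fun h => hB (h hBq)
  refine ⟨cJp, cJq, fun T hT => ⟨hp_F hT, hp_H hT⟩, fun T hT => ⟨hq_F hT, hq_H hT⟩, ⟨hpq, hqp⟩,
    ⟨A, hAp, hA⟩, ⟨B, hBq, hB⟩, ⟨fun T hT => ⟨hp_F (hpq_p hT), hp_H (hpq_p hT)⟩, fun h => ?_⟩, ?_⟩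
  · exact hpq fun T hT => hpq_q (h ⟨hp_F hT, hp_H hT⟩)
  obtain ⟨R, hRH, hRF⟩ := exists_mem_factorIdeal_id_not_fss hp1 hp2.le h2q.le hq.ne
  obtain ⟨U, hUF, hUH⟩ := exists_fss_notMem_factorIdeal_id hp2 h2q hq.ne
  have hI : formalInclusion p q (hp2.trans h2q).le ∈ Jpq := formalInclusion_mem_factorIdeal _
  have hIK : formalInclusion p q (hp2.trans h2q).le ∉ K :=
    formalInclusion_notMem_factorIdeal_real _ hq.ne
  have hHF : ¬ H ≤ F := fun h => hRF (h hRH)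
  have hFH : ¬ F ≤ H := fun h => hUH (h hUF)
  have hKne : ∀ J : Submodule ℝ (Ell p →L[ℝ] Ell q), Jpq ≤ J → K ≠ J := fun J hJ h =>
    hIK (h ▸ hJ hI)
  have hpq_V := hpq_p.trans hp_V
  have hbot : ∀ J : Submodule ℝ (Ell p →L[ℝ] Ell q), Jpq ≤ J → J ≠ ⊥ := fun J hJ h => by
    have h1 := hJ hI
    rw [h, Submodule.mem_bot] at h1
    exact hIK (h1 ▸ K.zero_mem)
  have htop : ∀ J : Submodule ℝ (Ell p →L[ℝ] Ell q), J ≤ F → J ≠ ⊤ := fun J hJ h =>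
    hHF (le_top.trans (h ▸ hJ))
  refine seven_le_encard (a₁ := K) (a₂ := Jpq) (a₃ := Jp) (a₄ := Jq) (a₅ := V) (a₆ := F)
    (a₇ := H) ?_ ?_
  · simp only [List.nodup_cons, List.mem_cons, List.not_mem_nil, or_false, not_or, not_false_iff,
      and_true, List.nodup_nil]
    refine ⟨⟨hKne _ le_rfl, hKne _ hpq_p, hKne _ hpq_q, hKne _ hpq_V, hKne _ (hpq_V.trans hV_F),
      hKne _ (hpq_V.trans hV_H)⟩, ⟨?_, ?_, ?_, ?_, ?_⟩, ⟨?_, ?_, ?_, ?_⟩, ⟨?_, ?_, ?_⟩, ⟨?_, ?_⟩,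
      ?_⟩
    · exact fun h => hpq (h ▸ hpq_q)
    · exact fun h => hqp (h ▸ hpq_p)
    · exact fun h => hpq ((hp_V.trans h.ge).trans hpq_q)
    · exact fun h => hFH ((h.ge.trans hpq_V).trans hV_H)
    · exact fun h => hHF ((h.ge.trans hpq_V).trans hV_F)
    · exact fun h => hpq h.le
    · exact fun h => hqp (hq_V.trans h.ge)
    · exact fun h => hFH (h.ge.trans hp_H)
    · exact fun h => hHF (h.ge.trans hp_F)
    · exact fun h => hpq (hp_V.trans h.ge)
    · exact fun h => hFH (h.ge.trans hq_H)
    · exact fun h => hHF (h.ge.trans hq_F)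
    · exact fun h => hFH (h.ge.trans hV_H)
    · exact fun h => hHF (h.ge.trans hV_F)
    · exact fun h => hFH h.le
  · have hKF : K ≠ ⊤ := fun h => hIK (h ▸ Submodule.mem_top)
    simp only [List.mem_cons, List.not_mem_nil, or_false]
    rintro J (rfl | rfl | rfl | rfl | rfl | rfl | rfl)
    · exact ⟨cK, factorIdeal_real_ne_bot, hKF⟩
    · exact ⟨cJpq, hbot _ le_rfl, htop _ (hpq_V.trans hV_F)⟩
    · exact ⟨cJp, hbot _ hpq_p, htop _ hp_F⟩
    · exact ⟨cJq, hbot _ hpq_q, htop _ hq_F⟩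
    · exact ⟨cV, hbot _ hpq_V, htop _ hV_F⟩
    · exact ⟨cF, hbot _ (hpq_V.trans hV_F), htop _ le_rfl⟩
    · exact ⟨cH, hbot _ (hpq_V.trans hV_H), fun h => hFH (h ▸ le_top)⟩
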